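/- **Setting.** All logarithms are natural. Let $\mathbb{X}$ be a finite alphabet. A source $\mathbf{X}=(P_{X^n})_n$ is a sequence of PMFs $P_{X^n}$ on $\mathbb{X}^n$ (no consistency required). For PMFs on a finite set, $H$ is the Shannon entropy and $D(\cdot\|\cdot)$ the Kullback–Leibler divergence ($+\infty$ unless absolutely continuous). For $R,\rho>0$ put $$E_n^s(R,\rho)=\min_{L_n}\frac1n\ln \mathbb{E}\big[\exp\{\rho\min\{L_n(X^n)\ln 2,\;nR\}\}\big],$$ the minimum being over all $L_n:\mathbb{X}^n\to\mathbb{N}$ with $\sum_{x^n}2^{-L_n(x^n)}\le 1$, and let $E_u^s=\limsup_n E_n^s$, $E_l^s=\liminf_n E_n^s$. For sources $\mathbf{Y},\mathbf{X}$ and $\theta\ge 0$ let $$D_u(\mathbf{Y}\|\mathbf{X})=\limsup_n\tfrac1n D(P_{Y^n}\|P_{X^n}),$$ let $E_u(\mathbf{Y},\mathbf{X},\theta)$ and $E_l(\mathbf{Y},\mathbf{X},\theta)$ be the $\limsup$ and $\liminf$ of $\frac1n\{\theta H(P_{Y^n})-D(P_{Y^n}\|P_{X^n})\}$, and let $$\overline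 H(\mathbf{Y})=\inf\{t:\lim_n\Pr\{\tfrac1n\ln\tfrac1{P_{Y^n}(Y^n)}>t\}=0\},\qquad \underline H(\mathbf{Y})=\sup\{t:\lim_n\Pr\{\tfrac1n\ln\tfrac1{P_{Y^n}(Y^n)}<t\}=0\}.$$ Define the general lower and upper bounds (with $\inf\emptyset=+\infty$, $\sup\emptyset=-\infty$) $$B_l(R,\rho)=\max\Big\{\rho R-\inf_{\mathbf{Y}:\underline H(\mathbf{Y})>R}D_u(\mathbf{Y}\|\mathbf{X}),\ \sup_{\mathbf{Y}:\overline H(\mathbf{Y})\le R}E_l(\mathbf{Y},\mathbf{X},\rho)\Big\},$$ $$B_u(R,\rho)=\inf_{0\le\theta\le\rho}\Big\{(\rho-\theta)R+\sup_{\mathbf{Y}}E_u(\mathbf{Y},\mathbf{X},\theta)\Big\}.$$ For a finite set $S$ and a transition matrix $\pi$ on $S$ put $$E_\pi(R,\rho)=\sup_{Q}\big\{\rho\min\{H(\eta\mid q),R\}-D(\eta\|\pi\mid q)\big\},$$ the supremum being over all PMFs $Q$ on $S^2$ with equal marginals. Here $q$ is the common marginal, $Q=q\times\eta$ (with $\eta(\cdot\mid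 s)$ uniform if $q(s)=0$), $H(\eta\mid q)=\sum_s q(s)H(\eta(\cdot\mid s))$ and $D(\eta\|\pi\mid q)=\sum_s q(s)D(\eta(\cdot\mid s)\|\pi(\cdot\mid s))$, with $0\cdot\infty=0$. **Statement.** Let $R>0$ and $\rho>0$. 1. (Markov source.) Let $\mathbf{X}$ be an irreducible stationary Markov source on $\mathbb{X}$ with transition matrix $\pi$. Then $$B_l(R,\rho)=E_l^s(R,\rho)=E_u^s(R,\rho)=B_u(R,\rho)=E_\pi(R,\rho).$$ 2. (Unifilar source.) Let $(Z_i)_{i\ge1}$ be an irreducible stationary Markov chain on a finite state space $S$ with transition matrix $\pi$, and let $f:S\to\mathbb{X}$ be such that, for each state $s$, the states reachable from $s$ in one step carry distinct letters (if $\pi(t\mid s)>0$, $\pi(u\mid s)>0$ and $f(t)=f(u)$, then $t=u$). Let $\mathbf{X}$ be the source of laws of $X^n=(f(Z_1),\dots,f(Z_n))$. Then $$B_l(R,\rho)=E_l^s(R,\rho)=E_u^s(R,\rho)=B_u(R,\rho)=E_\pi(R,\rho),$$ with $E_\pi$ computed for the state chain on $S$. -/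

import Mathlib

namespace ShannonCipher

open Filter Topology

/-! Sources over a finite alphabet.  A PMF on a finite set `α` is an element of `stdSimplex ℝ α`.
All logarithms are natural, so entropies, divergences and rates are in nats. -/

/-- A family of functions on the sets of `n`-letter messages (a source if each one is a PMF). -/
abbrev MessageLaw (X : Type*) := ∀ n : ℕ, (Fin n → X) → ℝ

/-- A source: a sequence of PMFs, the `n`-th one on `X ^ n`. No consistency is required. -/
def IsSource {X : Type*} [Fintype X] (P : MessageLaw X) : Prop :=
  ∀ n, P n ∈ stdSimplex ℝ (Fin n → X)

/-- Shannon entropy in nats. -/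
noncomputable def entropy {α : Type*} [Fintype α] (p : α → ℝ) : ℝ :=
  ∑ a, Real.negMulLog (p a)

open Classical in
/-- Kullback-Leibler divergence `D(p ‖ q)` in nats; it is `∞` unless `p ≪ q`. -/
noncomputable def divergence {α : Type*} [Fintype α] (p q : α → ℝ) : EReal :=
  if ∀ a, q a = 0 → p a = 0 then ((∑ a, p a * Real.log (p a / q a) : ℝ) : EReal) else ⊤

/-! The compression problem with saturated exponential cost. -/

/-- Kraft's inequality for a binary code alphabet. -/
def Kraft {α : Type*} [Fintype α] (L : α → ℕ) : Prop :=
  ∑ a, (2 : ℝ)⁻¹ ^ L a ≤ 1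

/-- Normalized exponent of the expected cost of the length function `L` on `X ^ n`. -/
noncomputable def costExponent {X : Type*} [Fintype X] (P : MessageLaw X) (R ρ : ℝ) (n : ℕ)
    (L : (Fin n → X) → ℕ) : ℝ :=
  1 / (n : ℝ) *
    Real.log (∑ x, P n x * Real.exp (ρ * min ((L x : ℝ) * Real.log 2) ((n : ℝ) * R)))

/-- `E_n^s(R, ρ)`: the smallest cost exponent of a length function on `X ^ n`. -/
noncomputable def compressionExponent {X : Type*} [Fintype X] (P : MessageLaw X) (R ρ : ℝ)
    (n : ℕ) : EReal :=
  ⨅ L : {L : (Fin n → X) → ℕ // Kraft L}, ((costExponent P R ρ n L.1 : ℝ) : EReal)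

/-- `E_u^s(R, ρ)`. -/
noncomputable def upperExponent {X : Type*} [Fintype X] (P : MessageLaw X) (R ρ : ℝ) : EReal :=
  limsup (fun n => compressionExponent P R ρ n) atTop

/-- `E_l^s(R, ρ)`. -/
noncomputable def lowerExponent {X : Type*} [Fintype X] (P : MessageLaw X) (R ρ : ℝ) : EReal :=
  liminf (fun n => compressionExponent P R ρ n) atTop

/-! Information-spectrum quantities and the two general bounds. -/

/-- `D_u(Y ‖ X)`, the upper divergence rate of the source `Q` from the source `P`. -/
noncomputable def upperDivergence {X : Type*} [Fintype X] (Q P : MessageLaw X) : EReal :=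
  limsup (fun n : ℕ => ((1 / (n : ℝ) : ℝ) : EReal) * divergence (Q n) (P n)) atTop

/-- `(1 / n) (ρ H(Y^n) - D(Y^n ‖ X^n))`. -/
noncomputable def tradeoff {X : Type*} [Fintype X] (Q P : MessageLaw X) (ρ : ℝ) (n : ℕ) : EReal :=
  ((1 / (n : ℝ) : ℝ) : EReal) * (((ρ * entropy (Q n) : ℝ) : EReal) - divergence (Q n) (P n))

/-- `E_u(Y, X, ρ)`. -/
noncomputable def upperTradeoff {X : Type*} [Fintype X] (Q P : MessageLaw X) (ρ : ℝ) : EReal :=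
  limsup (fun n => tradeoff Q P ρ n) atTop

/-- `E_l(Y, X, ρ)`. -/
noncomputable def lowerTradeoff {X : Type*} [Fintype X] (Q P : MessageLaw X) (ρ : ℝ) : EReal :=
  liminf (fun n => tradeoff Q P ρ n) atTop

/-- Probability, under `Q n`, that `(1 / n) ln (1 / Q n)` exceeds `t`. -/
noncomputable def probAbove {X : Type*} [Fintype X] (Q : MessageLaw X) (t : ℝ) (n : ℕ) : ℝ :=
  ∑ x with t < 1 / (n : ℝ) * Real.log (1 / Q n x), Q n x

/-- Probability, under `Q n`, that `(1 / n) ln (1 / Q n)` is below `t`. -/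
noncomputable def probBelow {X : Type*} [Fintype X] (Q : MessageLaw X) (t : ℝ) (n : ℕ) : ℝ :=
  ∑ x with 1 / (n : ℝ) * Real.log (1 / Q n x) < t, Q n x

/-- Spectral sup-entropy-rate. -/
noncomputable def supEntropyRate {X : Type*} [Fintype X] (Q : MessageLaw X) : EReal :=
  ⨅ (t : ℝ) (_ : Tendsto (probAbove Q t) atTop (𝓝 0)), (t : EReal)

/-- Spectral inf-entropy-rate. -/
noncomputable def infEntropyRate {X : Type*} [Fintype X] (Q : MessageLaw X) : EReal :=
  ⨆ (t : ℝ) (_ : Tendsto (probBelow Q t) atTop (𝓝 0)), (t : EReal)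

/-- The general lower bound on `E_l^s(R, ρ)`:
`max {ρ R - inf {D_u(Y ‖ X) | inf-entropy-rate of Y > R},
      sup {E_l(Y, X, ρ) | sup-entropy-rate of Y ≤ R}}`. -/
noncomputable def generalLowerBound {X : Type*} [Fintype X] (P : MessageLaw X) (R ρ : ℝ) : EReal :=
  max
    (((ρ * R : ℝ) : EReal) -
      ⨅ (Q : MessageLaw X) (_ : IsSource Q) (_ : (R : EReal) < infEntropyRate Q),
        upperDivergence Q P)
    (⨆ (Q : MessageLaw X) (_ : IsSource Q) (_ : supEntropyRate Q ≤ (R : EReal)),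
      lowerTradeoff Q P ρ)

/-- The general upper bound on `E_u^s(R, ρ)`:
`inf over 0 ≤ θ ≤ ρ of {(ρ - θ) R + sup over all sources Y of E_u(Y, X, θ)}`. -/
noncomputable def generalUpperBound {X : Type*} [Fintype X] (P : MessageLaw X) (R ρ : ℝ) : EReal :=
  ⨅ θ ∈ Set.Icc (0 : ℝ) ρ,
    ((((ρ - θ) * R : ℝ) : EReal) +
      ⨆ (Q : MessageLaw X) (_ : IsSource Q), upperTradeoff Q P θ)

/-! Markov and unifilar sources. -/

/-- `π` is an irreducible transition probability matrix with stationary distribution `p`. -/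
structure IsIrreducibleStationary {S : Type*} [Fintype S] (π : Matrix S S ℝ) (p : S → ℝ) :
    Prop where
  stochastic : ∀ s, π s ∈ stdSimplex ℝ S
  irreducible : π.IsIrreducible
  initial : p ∈ stdSimplex ℝ S
  stationary : Matrix.vecMul p π = p

/-- Law of the first `n` letters of the Markov chain with initial distribution `p` and transition
matrix `π`: `p(x_1) π(x_2 | x_1) ⋯ π(x_n | x_{n-1})`. -/
def markovLaw {S : Type*} (p : S → ℝ) (π : Matrix S S ℝ) : MessageLaw S
  | 0, _ => 1
  | n + 1, x => p (x 0) * ∏ i : Fin n, π (x i.castSucc) (x i.succ)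

/-- The letter map `f` on states is unifilar for `π`: from each state, the states that can be
reached in one step carry distinct letters. -/
def IsUnifilar {S X : Type*} (π : Matrix S S ℝ) (f : S → X) : Prop :=
  ∀ s t u, 0 < π s t → 0 < π s u → f t = f u → t = u

open Classical in
/-- Law of the first `n` letters `f(s_1), …, f(s_n)` put out by the state chain. -/
noncomputable def outputLaw {S X : Type*} [Fintype S] (p : S → ℝ) (π : Matrix S S ℝ) (f : S → X) :
    MessageLaw X :=
  fun n x => ∑ s : Fin n → S with f ∘ s = x, markovLaw p π n s

/-! The single-letter formula. -/

/-- Stationary PMFs on `S × S`: the two marginals agree. -/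
def stationaryPairs (S : Type*) [Fintype S] : Set (S × S → ℝ) :=
  {Q | Q ∈ stdSimplex ℝ (S × S) ∧ ∀ s, ∑ t, Q (t, s) = ∑ t, Q (s, t)}

/-- The marginal `q` of `Q`. -/
def marginal {S : Type*} [Fintype S] (Q : S × S → ℝ) (s : S) : ℝ :=
  ∑ t, Q (s, t)

open Classical in
/-- The conditional distribution `η(· | s)` of `Q = q × η`, uniform where `q` vanishes. -/
noncomputable def condDist {S : Type*} [Fintype S] (Q : S × S → ℝ) (s t : S) : ℝ :=
  if marginal Q s ≠ 0 then Q (s, t) / marginal Q s else 1 / (Fintype.card S : ℝ)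

/-- `H(η | q)`. -/
noncomputable def condEntropy {S : Type*} [Fintype S] (Q : S × S → ℝ) : ℝ :=
  ∑ s, marginal Q s * entropy (condDist Q s)

/-- `D(η ‖ π | q)`, with the convention `0 · ∞ = 0`. -/
noncomputable def condDivergence {S : Type*} [Fintype S] (Q : S × S → ℝ) (π : Matrix S S ℝ) :
    EReal :=
  ∑ s, (marginal Q s : EReal) * divergence (condDist Q s) (π s)

/-- `sup {ρ min {H(η | q), R} - D(η ‖ π | q)}` over all stationary PMFs `Q = q × η`. -/
noncomputable def markovExponent {S : Type*} [Fintype S] (π : Matrix S S ℝ) (R ρ : ℝ) : EReal :=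
  ⨆ Q ∈ stationaryPairs S,
    (((ρ * min (condEntropy Q) R : ℝ) : EReal) - condDivergence Q π)

end ShannonCipher

/-!
All the quantities are equal because of the cycle `E_π ≤ B_l ≤ E_l^s ≤ E_u^s ≤ B_u ≤ E_π`.

* `B_l ≤ E_l^s` is the Donsker–Varadhan inequality `ln E_X[exp g] ≥ E_Y[g] - D(Y ‖ X)` applied to
  the truncated code length, whose mean under `Y` is at least about `min {H(Y), nR}`.
* `E_u^s ≤ B_u`: a Shannon code for the tilted law proportional to `P_X ^ (1 / (1 + θ))` costs
  `(1 + θ) ln ∑ P_X ^ (1 / (1 + θ))`, which is the maximum over `Y` of `θ H(Y) - D(Y ‖ X)`.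
* `B_u ≤ E_π`: for a Markov chain this maximum grows like the logarithm of a Perron eigenvalue,
  the value of a variational problem over stationary pair distributions; a minimax theorem
  exchanges it with the infimum over `θ`.
* `E_π ≤ B_l`: for `Q = q × η` positive on the transitions of `π`, the competitor `Y` is the output
  of the chain `η` started at a single state. Unifilarity makes the output determine the path,
  and the ergodic theorem, from a martingale decomposition through Poisson's equation, makes its
  surprisal concentrate. Continuity in `Q` covers the other pairs.
-/

namespace ShannonCipher

open Filter Topology

/-! ### Entropy and divergence on a finite set -/

section Information

variable {α : Type*} [Fintype α] {p q : α → ℝ}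

omit [Fintype α] in
/-- Absolute continuity `p ≪ q` of two weight functions. -/
def AbsCont (p q : α → ℝ) : Prop :=
  ∀ a, q a = 0 → p a = 0

/-- The real sum computing the divergence `D(p ‖ q)` when `p ≪ q`; otherwise, as `log 0 = 0`, its
value is meaningless. -/
noncomputable def klSum (p q : α → ℝ) : ℝ :=
  ∑ a, p a * (Real.log (p a) - Real.log (q a))

lemma divergence_of_absCont (h : AbsCont p q) : divergence p q = (klSum p q : EReal) := by
  refine (if_pos h).trans (congrArg _ <| Finset.sum_congr rfl fun a _ => ?_)
  rcases eq_or_ne (p a) 0 with hp | hp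
  · simp [hp]
  · rw [Real.log_div hp (mt (h a) hp)]

lemma divergence_of_not_absCont (h : ¬ AbsCont p q) : divergence p q = ⊤ :=
  if_neg h

lemma entropy_eq_neg_sum (p : α → ℝ) : entropy p = -∑ a, p a * Real.log (p a) := by
  simp [entropy, Real.negMulLog]

lemma klSum_eq_neg_entropy_sub (p q : α → ℝ) :
    klSum p q = -entropy p - ∑ a, p a * Real.log (q a) := by
  simp only [klSum, entropy_eq_neg_sum, mul_sub, Finset.sum_sub_distrib, neg_neg]

lemma mul_log_sub_log_le_sub {x w : ℝ} (hx : 0 ≤ x) (hw : 0 ≤ w) (h : w = 0 → x = 0) :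
    x * (Real.log w - Real.log x) ≤ w - x := by
  rcases hx.eq_or_lt with rfl | hx
  · simpa using hw
  have hw' : 0 < w := hw.lt_of_ne fun h0 => hx.ne' (h h0.symm)
  rw [← Real.log_div hw'.ne' hx.ne']
  calc x * Real.log (w / x) ≤ x * (w / x - 1) := by
        gcongr; exact Real.log_le_sub_one_of_pos (by positivity)
    _ = w - x := by field_simp

lemma sum_mul_log_le_neg_entropy {w : α → ℝ} (hp : p ∈ stdSimplex ℝ α) (hw : ∀ a, 0 ≤ w a)
    (hw₁ : ∑ a, w a ≤ 1) (h : AbsCont p w) : ∑ a, p a * Real.log (w a) ≤ -entropy p := by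
  have := Finset.sum_le_sum fun a (_ : a ∈ Finset.univ) =>
    mul_log_sub_log_le_sub (hp.1 a) (hw a) (h a)
  simp only [mul_sub, Finset.sum_sub_distrib, hp.2] at this
  rw [entropy_eq_neg_sum]
  linarith

lemma sum_negMulLog_le_sum_mul_log_card [Nonempty α] (s : Finset α) (hp : ∀ a, 0 ≤ p a) :
    ∑ a ∈ s, Real.negMulLog (p a) ≤ (∑ a ∈ s, p a) * Real.log (Fintype.card α) + 1 := by
  set N := (Fintype.card α : ℝ) with hNdef
  have hN : 0 < N := by rw [hNdef]; exact_mod_cast Fintype.card_pos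
  have hle : ∀ a, Real.negMulLog (p a) ≤ p a * Real.log N + N⁻¹ := fun a => by
    have := mul_log_sub_log_le_sub (hp a) (inv_nonneg.2 hN.le) fun h => absurd h (inv_pos.2 hN).ne'
    rw [Real.log_inv] at this
    rw [Real.negMulLog]
    linarith [hp a]
  have hcard : ∑ _a ∈ s, N⁻¹ ≤ 1 := by
    rw [Finset.sum_const, nsmul_eq_mul, ← div_eq_mul_inv, div_le_one hN]
    rw [hNdef]
    exact_mod_cast s.card_le_univ
  calc ∑ a ∈ s, Real.negMulLog (p a) ≤ ∑ a ∈ s, (p a * Real.log N + N⁻¹) :=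
        Finset.sum_le_sum fun a _ => hle a
    _ ≤ (∑ a ∈ s, p a) * Real.log N + 1 := by
        rw [Finset.sum_add_distrib, ← Finset.sum_mul]
        gcongr

lemma exists_pos_of_mem_stdSimplex (hp : p ∈ stdSimplex ℝ α) : ∃ a, 0 < p a := by
  by_contra! h
  have h₀ : ∑ a, p a = 0 := Finset.sum_eq_zero fun a _ => le_antisymm (h a) (hp.1 a)
  exact zero_ne_one (h₀.symm.trans hp.2)

/-- The easy half of the Donsker-Varadhan formula: compare `p` with the Gibbs measure
`q exp g / Z`. -/
lemma sum_mul_sub_klSum_le_log_sum_exp (hp : p ∈ stdSimplex ℝ α) (hq : ∀ a, 0 ≤ q a)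
    (h : AbsCont p q) (g : α → ℝ) :
    ∑ a, p a * g a - klSum p q ≤ Real.log (∑ a, q a * Real.exp (g a)) := by
  set Z := ∑ a, q a * Real.exp (g a)
  have hterm : ∀ a, 0 ≤ q a * Real.exp (g a) := fun a => mul_nonneg (hq a) (Real.exp_pos _).le
  have hZ : 0 < Z := by
    obtain ⟨a, ha⟩ := exists_pos_of_mem_stdSimplex hp
    have hqa : 0 < q a := (hq a).lt_of_ne' fun h₀ => ha.ne' (h a h₀)
    exact Finset.sum_pos' (fun b _ => hterm b) ⟨a, Finset.mem_univ a, by positivity⟩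
  have hgibbs := sum_mul_log_le_neg_entropy hp (w := fun a => q a * Real.exp (g a) / Z)
    (fun a => div_nonneg (hterm a) hZ.le) (by rw [← Finset.sum_div, div_self hZ.ne'])
    (fun a ha => h a (by simpa [hZ.ne', (Real.exp_pos _).ne'] using ha))
  have hlog : ∀ a, p a * Real.log (q a * Real.exp (g a) / Z) =
      p a * Real.log (q a) + p a * g a - p a * Real.log Z := fun a => by
    rcases eq_or_ne (p a) 0 with hpa | hpa
    · simp [hpa]
    have hqa : q a ≠ 0 := mt (h a) hpa
    rw [Real.log_div (mul_ne_zero hqa (Real.exp_pos _).ne') hZ.ne',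
      Real.log_mul hqa (Real.exp_pos _).ne', Real.log_exp]
    ring
  simp only [hlog, Finset.sum_add_distrib, Finset.sum_sub_distrib, ← Finset.sum_mul, hp.2] at hgibbs
  rw [klSum_eq_neg_entropy_sub]
  linarith

end Information

/-! ### Limits in the extended reals -/

section Limits

variable {ι : Type*} {l : Filter ι} {u v : ι → EReal}

lemma liminf_le_liminf_of_forall_pos
    (h : ∀ ε : ℝ, 0 < ε → ∀ᶠ i in l, u i ≤ v i + (ε : EReal)) : liminf u l ≤ liminf v l := by
  refine le_of_forall_lt fun c hc => ?_
  obtain ⟨d, hcd, hd⟩ := EReal.lt_iff_exists_real_btwn.1 hc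
  obtain ⟨e, hde, he⟩ := EReal.lt_iff_exists_real_btwn.1 hd
  refine hcd.trans_le (le_liminf_of_le (by isBoundedDefault) ?_)
  filter_upwards [h (e - d) (sub_pos.2 (by exact_mod_cast hde)), eventually_lt_of_lt_liminf he]
    with i hi hei
  have := EReal.sub_le_of_le_add (hei.le.trans hi)
  rwa [← EReal.coe_sub, sub_sub_cancel] at this

lemma limsup_le_limsup_of_forall_pos
    (h : ∀ ε : ℝ, 0 < ε → ∀ᶠ i in l, u i ≤ v i + (ε : EReal)) : limsup u l ≤ limsup v l := by
  refine le_of_forall_gt fun c hc => ?_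
  obtain ⟨d, hd, hdc⟩ := EReal.lt_iff_exists_real_btwn.1 hc
  obtain ⟨e, he, hed⟩ := EReal.lt_iff_exists_real_btwn.1 hd
  refine lt_of_le_of_lt (limsup_le_of_le (by isBoundedDefault) ?_) hdc
  filter_upwards [h (d - e) (sub_pos.2 (by exact_mod_cast hed)), eventually_lt_of_limsup_lt he]
    with i hi hie
  calc u i ≤ v i + ((d - e : ℝ) : EReal) := hi
    _ ≤ (e : EReal) + ((d - e : ℝ) : EReal) := by gcongr
    _ = (d : EReal) := by rw [← EReal.coe_add, add_sub_cancel]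

lemma coe_sub_le_coe_sub_add {x y ε : ℝ} (h : x ≤ y + ε) (d : EReal) :
    (x : EReal) - d ≤ (y : EReal) - d + (ε : EReal) := by
  calc (x : EReal) - d ≤ ((y + ε : ℝ) : EReal) - d :=
        EReal.sub_le_sub (EReal.coe_le_coe_iff.2 h) le_rfl
    _ = (y : EReal) - d + (ε : EReal) := by
        rw [EReal.coe_add, sub_eq_add_neg, add_right_comm, ← sub_eq_add_neg]

lemma coe_sub_le_comm (a : ℝ) {x y : EReal} : (a : EReal) - x ≤ y ↔ (a : EReal) - y ≤ x := by
  induction x <;> induction y <;> norm_cast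
  case coe.coe => exact sub_le_comm
  case bot.coe | coe.bot => simpa using EReal.coe_ne_bot (_ - _)
  all_goals simp

lemma tendsto_one_div_nat_mul (c : ℝ) : Tendsto (fun n : ℕ => 1 / (n : ℝ) * c) atTop (𝓝 0) := by
  simpa using tendsto_one_div_atTop_nhds_zero_nat.mul_const c

lemma eventually_one_div_nat_mul_le (c : ℝ) {ε : ℝ} (hε : 0 < ε) :
    ∀ᶠ n : ℕ in atTop, 1 / (n : ℝ) * c ≤ ε :=
  ((tendsto_one_div_nat_mul c).eventually_lt_const hε).mono fun _ => le_of_lt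

lemma tendsto_coe_add_one_div_nat_mul (c d : ℝ) :
    Tendsto (fun n : ℕ => ((c + 1 / (n : ℝ) * d : ℝ) : EReal)) atTop (𝓝 c) :=
  (continuous_coe_real_ereal.tendsto c).comp
    (by simpa using (tendsto_one_div_nat_mul d).const_add c)

lemma limsup_one_div_nat_mul_le {a : ℕ → ℝ} {c d : ℝ} (h : ∀ m : ℕ, a (m + 1) ≤ (m + 1) * c + d) :
    limsup (fun n : ℕ => ((1 / (n : ℝ) * a n : ℝ) : EReal)) atTop ≤ c := by
  rw [← (tendsto_coe_add_one_div_nat_mul c d).limsup_eq]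
  refine limsup_le_limsup ?_
  filter_upwards [eventually_gt_atTop 0] with n hn
  obtain ⟨m, rfl⟩ := Nat.exists_eq_add_one.2 hn
  rw [EReal.coe_le_coe_iff, one_div_mul_eq_div, one_div_mul_eq_div, div_le_iff₀ (by positivity),
    add_mul, div_mul_cancel₀ _ (by positivity), mul_comm c]
  exact_mod_cast h m

lemma le_liminf_one_div_nat_mul {a : ℕ → ℝ} {c d : ℝ} (h : ∀ m : ℕ, (m + 1) * c + d ≤ a (m + 1)) :
    c ≤ liminf (fun n : ℕ => ((1 / (n : ℝ) * a n : ℝ) : EReal)) atTop := by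
  rw [← (tendsto_coe_add_one_div_nat_mul c d).liminf_eq]
  refine liminf_le_liminf ?_
  filter_upwards [eventually_gt_atTop 0] with n hn
  obtain ⟨m, rfl⟩ := Nat.exists_eq_add_one.2 hn
  rw [EReal.coe_le_coe_iff, one_div_mul_eq_div, one_div_mul_eq_div, le_div_iff₀ (by positivity),
    add_mul, div_mul_cancel₀ _ (by positivity), mul_comm c]
  exact_mod_cast h m

lemma lt_one_div_natCast_mul_iff {n : ℕ} (hn : 0 < n) {a t : ℝ} :
    t < 1 / (n : ℝ) * a ↔ n * t < a := by
  rw [one_div_mul_eq_div, lt_div_iff₀ (by exact_mod_cast hn), mul_comm]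

lemma one_div_natCast_mul_lt_iff {n : ℕ} (hn : 0 < n) {a t : ℝ} :
    1 / (n : ℝ) * a < t ↔ a < n * t := by
  rw [one_div_mul_eq_div, div_lt_iff₀ (by exact_mod_cast hn), mul_comm]

end Limits

/-! ### The general lower bound -/

section Converse

variable {α X : Type*} [Fintype α] [Fintype X]

/-- Mean under `q` of the code length in nats, truncated at `c`. -/
noncomputable def meanTruncatedLength (q : α → ℝ) (L : α → ℕ) (c : ℝ) : ℝ :=
  ∑ a, q a * min ((L a : ℝ) * Real.log 2) c

lemma natCast_mul_log_two_nonneg (k : ℕ) : 0 ≤ (k : ℝ) * Real.log 2 :=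
  mul_nonneg k.cast_nonneg (Real.log_nonneg one_le_two)

lemma exp_neg_natCast_mul_log_two (k : ℕ) :
    Real.exp (-((k : ℝ) * Real.log 2)) = (2 : ℝ)⁻¹ ^ k := by
  rw [Real.exp_neg, Real.exp_nat_mul, Real.exp_log two_pos, inv_pow]

lemma Kraft.sum_exp_le_one {L : α → ℕ} (hL : Kraft L) (s : Finset α) :
    ∑ a ∈ s, Real.exp (-((L a : ℝ) * Real.log 2)) ≤ 1 := by
  simp only [exp_neg_natCast_mul_log_two]
  exact (Finset.sum_le_sum_of_subset_of_nonneg s.subset_univ fun a _ _ => by positivity).trans hL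

lemma sum_mul_min_le_meanTruncatedLength {q : α → ℝ} (hq : ∀ a, 0 ≤ q a) (L : α → ℕ) {c : ℝ}
    (hc : 0 ≤ c) (s : Finset α) :
    ∑ a ∈ s, q a * min ((L a : ℝ) * Real.log 2) c ≤ meanTruncatedLength q L c :=
  Finset.sum_le_sum_of_subset_of_nonneg s.subset_univ fun a _ _ =>
    mul_nonneg (hq a) (le_min (natCast_mul_log_two_nonneg _) hc)

lemma negMulLog_le_mul_min_add_exp {x : ℝ} (hx : 0 ≤ x) (l : ℝ) {c δ : ℝ} (hδ : 0 ≤ δ)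
    (h : Real.log (1 / x) ≤ c + δ) :
    Real.negMulLog x ≤ x * (min l c + δ) + Real.exp (-l) := by
  rw [one_div, Real.log_inv] at h
  rw [Real.negMulLog]
  rcases le_total l c with hlc | hcl
  · have := mul_log_sub_log_le_sub hx (Real.exp_pos (-l)).le fun h => absurd h (Real.exp_pos _).ne'
    rw [Real.log_exp] at this
    rw [min_eq_left hlc]
    nlinarith [mul_nonneg hx hδ]
  · rw [min_eq_right hcl]
    nlinarith [mul_le_mul_of_nonneg_left h hx, Real.exp_pos (-l)]

/-- A code of short truncated length needs little entropy outside the atoms whose information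
content exceeds the truncation level. -/
lemma entropy_le_meanTruncatedLength_add [Nonempty α] {q : α → ℝ} (hq : q ∈ stdSimplex ℝ α)
    {L : α → ℕ} (hL : Kraft L) {c δ : ℝ} (hc : 0 ≤ c) (hδ : 0 ≤ δ) :
    entropy q ≤ meanTruncatedLength q L c + δ + 2 +
      (∑ a with c + δ < Real.log (1 / q a), q a) * Real.log (Fintype.card α) := by
  classical
  set T := Finset.univ.filter fun a => ¬ c + δ < Real.log (1 / q a)
  have hbad := sum_negMulLog_le_sum_mul_log_card
    (Finset.univ.filter fun a => c + δ < Real.log (1 / q a)) hq.1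
  have hgood : ∑ a ∈ T, Real.negMulLog (q a) ≤ ∑ a ∈ T, (q a * min ((L a : ℝ) * Real.log 2) c +
      q a * δ + Real.exp (-((L a : ℝ) * Real.log 2))) := Finset.sum_le_sum fun a ha => by
    rw [← mul_add]
    exact negMulLog_le_mul_min_add_exp (hq.1 a) _ hδ (not_lt.1 (Finset.mem_filter.1 ha).2)
  have hT : ∑ a ∈ T, q a ≤ 1 := hq.2 ▸
    Finset.sum_le_sum_of_subset_of_nonneg T.subset_univ fun a _ _ => hq.1 a
  rw [Finset.sum_add_distrib, Finset.sum_add_distrib, ← Finset.sum_mul] at hgood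
  rw [entropy, ← Finset.sum_filter_add_sum_filter_not _ fun a => c + δ < Real.log (1 / q a)]
  linarith [sum_mul_min_le_meanTruncatedLength hq.1 L hc T, hL.sum_exp_le_one T,
    mul_le_of_le_one_left hδ hT]

lemma mul_sub_exp_le_mul_min {x l c τ : ℝ} (hx : 0 ≤ x) (hl : 0 ≤ l) (hc : 0 ≤ c)
    (h : c + τ ≤ Real.log (1 / x)) :
    c * (x - Real.exp (-l) * Real.exp (-τ)) ≤ x * min l c := by
  have hexp : 0 < Real.exp (-l) * Real.exp (-τ) := by positivity
  rcases le_total c l with hcl | hlc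
  · rw [min_eq_right hcl, mul_comm x]
    gcongr
    linarith
  · have hx' : x ≤ Real.exp (-l) * Real.exp (-τ) := by
      rcases hx.eq_or_lt with rfl | hx
      · exact hexp.le
      rw [one_div, Real.log_inv] at h
      rw [← Real.exp_add, ← Real.log_le_iff_le_exp hx]
      linarith
    exact (mul_nonpos_of_nonneg_of_nonpos hc (sub_nonpos.2 hx')).trans
      (mul_nonneg hx (le_min hl hc))

lemma mul_one_sub_le_meanTruncatedLength {q : α → ℝ} (hq : q ∈ stdSimplex ℝ α) {L : α → ℕ}
    (hL : Kraft L) {c : ℝ} (hc : 0 ≤ c) (τ : ℝ) :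
    c * (1 - ∑ a with Real.log (1 / q a) < c + τ, q a - Real.exp (-τ)) ≤
      meanTruncatedLength q L c := by
  classical
  set T := Finset.univ.filter fun a => ¬ Real.log (1 / q a) < c + τ
  have hgood := Finset.sum_le_sum fun a (ha : a ∈ T) => mul_sub_exp_le_mul_min (hq.1 a)
    (natCast_mul_log_two_nonneg (L a)) hc (not_lt.1 (Finset.mem_filter.1 ha).2)
  rw [← Finset.mul_sum, Finset.sum_sub_distrib, ← Finset.sum_mul] at hgood
  refine le_trans ?_ (hgood.trans (sum_mul_min_le_meanTruncatedLength hq.1 L hc T))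
  have hsplit : ∑ a with Real.log (1 / q a) < c + τ, q a + ∑ a ∈ T, q a = 1 :=
    (Finset.sum_filter_add_sum_filter_not _ _ _).trans hq.2
  have hc_le : 1 - ∑ a with Real.log (1 / q a) < c + τ, q a = ∑ a ∈ T, q a := by linarith
  rw [hc_le]
  gcongr
  exact mul_le_of_le_one_left (Real.exp_pos _).le (hL.sum_exp_le_one T)

variable {P Q : MessageLaw X} {R ρ : ℝ}

lemma costExponent_ge (hP : IsSource P) (hQ : IsSource Q) (R ρ : ℝ) {n : ℕ}
    (h : AbsCont (Q n) (P n)) (L : (Fin n → X) → ℕ) :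
    1 / (n : ℝ) * (ρ * meanTruncatedLength (Q n) L (n * R) - klSum (Q n) (P n)) ≤
      costExponent P R ρ n L := by
  rw [costExponent]
  gcongr
  refine le_trans (le_of_eq ?_) (sum_mul_sub_klSum_le_log_sum_exp (hQ n) (hP n).1 h _)
  rw [meanTruncatedLength, Finset.mul_sum]
  exact congrArg (· - _) (Finset.sum_congr rfl fun x _ => mul_left_comm _ _ _)

lemma one_div_mul_divergence_of_not_absCont {p q : α → ℝ} (h : ¬ AbsCont p q) {n : ℕ}
    (hn : 0 < n) : ((1 / (n : ℝ) : ℝ) : EReal) * divergence p q = ⊤ := by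
  rw [divergence_of_not_absCont h, EReal.coe_mul_top_of_pos (by positivity)]

lemma coe_sub_divergence_le_compressionExponent (hP : IsSource P) (hQ : IsSource Q)
    (hρ : 0 ≤ ρ) {n : ℕ} (hn : 0 < n) {A : ℝ}
    (hA : ∀ L, Kraft L → A ≤ 1 / (n : ℝ) * meanTruncatedLength (Q n) L (n * R)) :
    ((ρ * A : ℝ) : EReal) - ((1 / (n : ℝ) : ℝ) : EReal) * divergence (Q n) (P n) ≤
      compressionExponent P R ρ n := by
  by_cases h : AbsCont (Q n) (P n)
  · rw [divergence_of_absCont h, ← EReal.coe_mul, ← EReal.coe_sub]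
    refine le_iInf fun ⟨L, hL⟩ => EReal.coe_le_coe_iff.2 ?_
    refine le_trans ?_ (costExponent_ge hP hQ R ρ h L)
    rw [mul_sub, mul_left_comm]
    gcongr
    exact hA L hL
  · rw [one_div_mul_divergence_of_not_absCont h hn, EReal.sub_top]
    exact bot_le

lemma liminf_sub_divergence_le_lowerExponent (hP : IsSource P) (hQ : IsSource Q) (hρ : 0 ≤ ρ)
    {a : ℕ → ℝ} (h : ∀ ε : ℝ, 0 < ε → ∀ᶠ n : ℕ in atTop, ∀ L, Kraft L →
      a n - ε ≤ 1 / (n : ℝ) * meanTruncatedLength (Q n) L (n * R)) :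
    liminf (fun n : ℕ => ((ρ * a n : ℝ) : EReal) -
      ((1 / (n : ℝ) : ℝ) : EReal) * divergence (Q n) (P n)) atTop ≤ lowerExponent P R ρ := by
  refine liminf_le_liminf_of_forall_pos fun ε hε => ?_
  obtain ⟨δ, hδ, hδε⟩ : ∃ δ > 0, ρ * δ ≤ ε := by
    refine ⟨ε / (ρ + 1), by positivity, ?_⟩
    rw [mul_div_left_comm]
    exact mul_le_of_le_one_right hε.le ((div_le_one (by positivity)).2 (by linarith))
  filter_upwards [h δ hδ, eventually_gt_atTop 0] with n hn hpos
  refine (coe_sub_le_coe_sub_add ?_ _).trans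
    (add_le_add_left (coe_sub_divergence_le_compressionExponent hP hQ hρ hpos hn) _)
  linarith

lemma tradeoff_eq_sub (Q P : MessageLaw X) (θ : ℝ) (n : ℕ) :
    tradeoff Q P θ n = ((θ * (1 / (n : ℝ) * entropy (Q n)) : ℝ) : EReal) -
      ((1 / (n : ℝ) : ℝ) : EReal) * divergence (Q n) (P n) := by
  rcases n.eq_zero_or_pos with rfl | hn
  · simp [tradeoff]
  by_cases h : AbsCont (Q n) (P n)
  · rw [tradeoff, divergence_of_absCont h]
    norm_cast
    ring
  · rw [tradeoff, one_div_mul_divergence_of_not_absCont h hn, divergence_of_not_absCont h,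
      EReal.sub_top, EReal.sub_top, EReal.coe_mul_bot_of_pos (by positivity)]

lemma tendsto_probAbove (hQ : IsSource Q) {t : ℝ} (h : supEntropyRate Q < (t : EReal)) :
    Tendsto (probAbove Q t) atTop (𝓝 0) := by
  simp only [supEntropyRate, iInf_lt_iff] at h
  obtain ⟨s, hs, hst⟩ := h
  have hst' : s < t := by exact_mod_cast hst
  refine squeeze_zero (fun n => Finset.sum_nonneg fun x _ => (hQ n).1 x) (fun n => ?_) hs
  exact Finset.sum_le_sum_of_subset_of_nonneg
    (Finset.monotone_filter_right _ fun x _ hx => hst'.trans hx) fun x _ _ => (hQ n).1 x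

lemma entropy_sub_probAbove_le_meanTruncatedLength [Nonempty X] (hQ : IsSource Q) (hR : 0 ≤ R)
    {δ : ℝ} (hδ : 0 ≤ δ) {n : ℕ} (hn : 0 < n) {L : (Fin n → X) → ℕ} (hL : Kraft L) :
    1 / (n : ℝ) * entropy (Q n) - δ - 1 / (n : ℝ) * 2 -
        probAbove Q (R + δ) n * Real.log (Fintype.card X) ≤
      1 / (n : ℝ) * meanTruncatedLength (Q n) L (n * R) := by
  have hn' : (0 : ℝ) < n := by exact_mod_cast hn
  have h := entropy_le_meanTruncatedLength_add (hQ n) hL (c := n * R) (δ := n * δ)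
    (by positivity) (by positivity)
  simp only [← mul_add, ← lt_one_div_natCast_mul_iff hn, Fintype.card_fun, Fintype.card_fin,
    Nat.cast_pow, Real.log_pow] at h
  change entropy (Q n) ≤ _ + probAbove Q (R + δ) n * _ at h
  have h' := mul_le_mul_of_nonneg_left h (one_div_nonneg.2 hn'.le)
  have hnδ : 1 / (n : ℝ) * (n * δ) = δ := by field_simp
  have hnp : 1 / (n : ℝ) * (probAbove Q (R + δ) n * (n * Real.log (Fintype.card X))) =
      probAbove Q (R + δ) n * Real.log (Fintype.card X) := by field_simp
  rw [mul_add, mul_add, mul_add, hnδ, hnp] at h'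
  linarith

lemma lowerTradeoff_le_lowerExponent [Nonempty X] (hP : IsSource P) (hQ : IsSource Q)
    (hR : 0 ≤ R) (hρ : 0 ≤ ρ) (h : supEntropyRate Q ≤ (R : EReal)) :
    lowerTradeoff Q P ρ ≤ lowerExponent P R ρ := by
  simp only [lowerTradeoff, tradeoff_eq_sub]
  refine liminf_sub_divergence_le_lowerExponent hP hQ hρ fun ε hε => ?_
  have hprob := tendsto_probAbove hQ (t := R + ε / 2)
    (h.trans_lt (by exact_mod_cast lt_add_of_pos_right R (half_pos hε)))
  have hlim : Tendsto (fun n : ℕ => 1 / (n : ℝ) * 2 +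
      probAbove Q (R + ε / 2) n * Real.log (Fintype.card X)) atTop (𝓝 0) := by
    simpa using (tendsto_one_div_nat_mul 2).add (hprob.mul_const (Real.log (Fintype.card X)))
  filter_upwards [hlim.eventually_lt_const (half_pos hε), eventually_gt_atTop 0] with n hn hpos
  intro L hL
  linarith [entropy_sub_probAbove_le_meanTruncatedLength hQ hR (half_pos hε).le hpos hL]

lemma mul_one_sub_probBelow_le_meanTruncatedLength (hQ : IsSource Q) (hR : 0 ≤ R) (t : ℝ)
    {n : ℕ} (hn : 0 < n) {L : (Fin n → X) → ℕ} (hL : Kraft L) :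
    R * (1 - probBelow Q t n - Real.exp (-(n * (t - R)))) ≤
      1 / (n : ℝ) * meanTruncatedLength (Q n) L (n * R) := by
  have hn' : (0 : ℝ) < n := by exact_mod_cast hn
  have h := mul_one_sub_le_meanTruncatedLength (hQ n) hL (c := n * R) (by positivity) (n * (t - R))
  simp only [← mul_add, add_sub_cancel, ← one_div_natCast_mul_lt_iff hn] at h
  rwa [one_div_mul_eq_div, le_div_iff₀ hn', mul_comm, ← mul_assoc]

lemma exists_tendsto_probBelow (h : (R : EReal) < infEntropyRate Q) :
    ∃ t, R < t ∧ Tendsto (probBelow Q t) atTop (𝓝 0) := by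
  simp only [infEntropyRate, lt_iSup_iff] at h
  obtain ⟨t, ht, hRt⟩ := h
  exact ⟨t, by exact_mod_cast hRt, ht⟩

lemma coe_sub_upperDivergence_le_liminf (c : ℝ) (Q P : MessageLaw X) :
    (c : EReal) - upperDivergence Q P ≤ liminf (fun n : ℕ => (c : EReal) -
      ((1 / (n : ℝ) : ℝ) : EReal) * divergence (Q n) (P n)) atTop := by
  simp only [sub_eq_add_neg]
  rw [upperDivergence, ← EReal.liminf_neg]
  refine le_trans (le_of_eq ?_) EReal.le_liminf_add
  rw [liminf_const]
  rfl

lemma sub_upperDivergence_le_lowerExponent (hP : IsSource P) (hQ : IsSource Q) (hR : 0 ≤ R)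
    (hρ : 0 ≤ ρ) (h : (R : EReal) < infEntropyRate Q) :
    ((ρ * R : ℝ) : EReal) - upperDivergence Q P ≤ lowerExponent P R ρ := by
  obtain ⟨t, hRt, ht⟩ := exists_tendsto_probBelow h
  refine (coe_sub_upperDivergence_le_liminf _ Q P).trans
    (liminf_sub_divergence_le_lowerExponent hP hQ hρ fun ε hε => ?_)
  have hexp : Tendsto (fun n : ℕ => Real.exp (-(n * (t - R)))) atTop (𝓝 0) :=
    Real.tendsto_exp_neg_atTop_nhds_zero.comp
      (tendsto_natCast_atTop_atTop.atTop_mul_const (sub_pos.2 hRt))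
  have hlim : Tendsto (fun n : ℕ => R * (probBelow Q t n + Real.exp (-(n * (t - R)))))
      atTop (𝓝 0) := by
    simpa using (ht.add hexp).const_mul R
  filter_upwards [hlim.eventually_lt_const hε, eventually_gt_atTop 0] with n hn hpos
  intro L hL
  linarith [mul_one_sub_probBelow_le_meanTruncatedLength hQ hR t hpos hL]

theorem generalLowerBound_le_lowerExponent [Nonempty X] (hP : IsSource P) (hR : 0 ≤ R)
    (hρ : 0 ≤ ρ) : generalLowerBound P R ρ ≤ lowerExponent P R ρ := by
  refine max_le ?_ (iSup₂_le fun Q hQ => iSup_le fun h =>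
    lowerTradeoff_le_lowerExponent hP hQ hR hρ h)
  rw [coe_sub_le_comm]
  refine le_iInf₂ fun Q hQ => le_iInf fun h => ?_
  rw [coe_sub_le_comm]
  exact sub_upperDivergence_le_lowerExponent hP hQ hR hρ h

end Converse

/-! ### The general upper bound -/

section Achievability

variable {α X : Type*} [Fintype α] [Fintype X] {p q : α → ℝ} {θ : ℝ}

/-- Normalizing constant of the distribution proportional to `p ^ (1 / (1 + θ))`. -/
noncomputable def tiltSum (p : α → ℝ) (θ : ℝ) : ℝ :=
  ∑ a, p a ^ (1 / (1 + θ))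

/-- The distribution proportional to `p ^ (1 / (1 + θ))`. -/
noncomputable def tilted (p : α → ℝ) (θ : ℝ) (a : α) : ℝ :=
  p a ^ (1 / (1 + θ)) / tiltSum p θ

/-- `(1 / n) (1 + θ) ln ∑ x, P x ^ (1 / (1 + θ))`, the largest value of
`(1 / n) (θ H(Y^n) - D(Y^n ‖ X^n))`. -/
noncomputable def tiltedExponent (P : MessageLaw X) (θ : ℝ) (n : ℕ) : ℝ :=
  1 / (n : ℝ) * ((1 + θ) * Real.log (tiltSum (P n) θ))

lemma tiltSum_pos (hp : p ∈ stdSimplex ℝ α) (θ : ℝ) : 0 < tiltSum p θ := by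
  obtain ⟨a, ha⟩ := exists_pos_of_mem_stdSimplex hp
  exact Finset.sum_pos' (fun b _ => Real.rpow_nonneg (hp.1 b) _)
    ⟨a, Finset.mem_univ _, Real.rpow_pos_of_pos ha _⟩

lemma tilted_mem_stdSimplex (hp : p ∈ stdSimplex ℝ α) (θ : ℝ) : tilted p θ ∈ stdSimplex ℝ α := by
  refine ⟨fun a => div_nonneg (Real.rpow_nonneg (hp.1 a) _) (tiltSum_pos hp θ).le, ?_⟩
  simp only [tilted, ← Finset.sum_div]
  exact div_self (tiltSum_pos hp θ).ne'

lemma tilted_eq_zero_iff (hp : p ∈ stdSimplex ℝ α) (hθ : 1 + θ ≠ 0) (a : α) :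
    tilted p θ a = 0 ↔ p a = 0 := by
  simp [tilted, (tiltSum_pos hp θ).ne', Real.rpow_eq_zero (hp.1 a), hθ]

lemma log_tilted (hp : p ∈ stdSimplex ℝ α) (θ : ℝ) {a : α} (ha : 0 < p a) :
    Real.log (tilted p θ a) = 1 / (1 + θ) * Real.log (p a) - Real.log (tiltSum p θ) := by
  rw [tilted, Real.log_div (Real.rpow_pos_of_pos ha _).ne' (tiltSum_pos hp θ).ne',
    Real.log_rpow ha]

lemma klSum_self (p : α → ℝ) : klSum p p = 0 := by
  simp [klSum]

lemma klSum_nonneg (hp : p ∈ stdSimplex ℝ α) (hq : q ∈ stdSimplex ℝ α) (h : AbsCont p q) :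
    0 ≤ klSum p q := by
  rw [klSum_eq_neg_entropy_sub]
  linarith [sum_mul_log_le_neg_entropy hp hq.1 hq.2.le h]

/-- The variational identity behind the tilted distribution: it exhibits `tilted q θ` as the
maximizer of `θ H(p) - D(p ‖ q)`. -/
lemma mul_entropy_sub_klSum_eq (hp : p ∈ stdSimplex ℝ α) (hq : q ∈ stdSimplex ℝ α)
    (h : AbsCont p q) (hθ : 1 + θ ≠ 0) :
    θ * entropy p - klSum p q =
      (1 + θ) * Real.log (tiltSum q θ) - (1 + θ) * klSum p (tilted q θ) := by
  have hlog : ∀ a, p a * Real.log (tilted q θ a) =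
      1 / (1 + θ) * (p a * Real.log (q a)) - p a * Real.log (tiltSum q θ) := fun a => by
    rcases (hq.1 a).eq_or_lt' with hqa | hqa
    · simp [h a hqa]
    · rw [log_tilted hq θ hqa]
      ring
  simp only [klSum_eq_neg_entropy_sub, hlog, Finset.sum_sub_distrib, ← Finset.mul_sum,
    ← Finset.sum_mul, hp.2]
  field_simp
  ring

variable {P Q : MessageLaw X} {R ρ : ℝ}

lemma tradeoff_of_absCont {n : ℕ} (h : AbsCont (Q n) (P n)) (θ : ℝ) :
    tradeoff Q P θ n =
      ((1 / (n : ℝ) * (θ * entropy (Q n) - klSum (Q n) (P n)) : ℝ) : EReal) := by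
  rw [tradeoff, divergence_of_absCont h]
  norm_cast

lemma tradeoff_tilted (hP : IsSource P) (hθ : 1 + θ ≠ 0) (n : ℕ) :
    tradeoff (fun n => tilted (P n) θ) P θ n = (tiltedExponent P θ n : EReal) := by
  have h : AbsCont (tilted (P n) θ) (P n) := fun x => (tilted_eq_zero_iff (hP n) hθ x).2
  rw [tradeoff_of_absCont h,
    mul_entropy_sub_klSum_eq (tilted_mem_stdSimplex (hP n) θ) (hP n) h hθ, klSum_self, mul_zero,
    sub_zero, tiltedExponent]

lemma tradeoff_le_tiltedExponent (hP : IsSource P) (hQ : IsSource Q) (hθ : 0 < 1 + θ) {n : ℕ}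
    (hn : 0 < n) : tradeoff Q P θ n ≤ (tiltedExponent P θ n : EReal) := by
  by_cases h : AbsCont (Q n) (P n)
  · rw [tradeoff_of_absCont h, mul_entropy_sub_klSum_eq (hQ n) (hP n) h hθ.ne', tiltedExponent]
    have hkl := klSum_nonneg (hQ n) (tilted_mem_stdSimplex (hP n) θ)
      fun x hx => h x ((tilted_eq_zero_iff (hP n) hθ.ne' x).1 hx)
    gcongr
    exact sub_le_self _ (by positivity)
  · rw [tradeoff_eq_sub, one_div_mul_divergence_of_not_absCont h hn, EReal.sub_top]
    exact bot_le

lemma iSup_upperTradeoff (hP : IsSource P) (hθ : 0 < 1 + θ) :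
    ⨆ (Q : MessageLaw X) (_ : IsSource Q), upperTradeoff Q P θ =
      limsup (fun n => (tiltedExponent P θ n : EReal)) atTop := by
  refine le_antisymm (iSup₂_le fun Q hQ => limsup_le_limsup ?_) ?_
  · filter_upwards [eventually_gt_atTop 0] with n hn
    exact tradeoff_le_tiltedExponent hP hQ hθ hn
  · refine le_iSup₂_of_le _ (fun n => tilted_mem_stdSimplex (hP n) θ) (le_of_eq ?_)
    exact congrArg (limsup · atTop) (funext fun n => (tradeoff_tilted hP hθ.ne' n).symm)

lemma exists_kraft_mul_log_two_le {r : α → ℝ} (hr : ∀ a, 0 < r a) (hr₁ : ∑ a, r a ≤ 1) :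
    ∃ L : α → ℕ, Kraft L ∧ ∀ a, (L a : ℝ) * Real.log 2 ≤ -Real.log (r a) + Real.log 2 := by
  have hlog₂ : 0 < Real.log 2 := Real.log_pos one_lt_two
  have hlog : ∀ a, 0 ≤ -Real.log (r a) / Real.log 2 := fun a =>
    div_nonneg (neg_nonneg.2 (Real.log_nonpos (hr a).le
      ((Finset.single_le_sum (fun b _ => (hr b).le) (Finset.mem_univ a)).trans hr₁))) hlog₂.le
  refine ⟨fun a => ⌈-Real.log (r a) / Real.log 2⌉₊, ?_, fun a => ?_⟩
  · refine (Finset.sum_le_sum fun a _ => ?_).trans hr₁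
    rw [← exp_neg_natCast_mul_log_two, ← Real.le_log_iff_exp_le (hr a), neg_le, ← div_le_iff₀ hlog₂]
    exact Nat.le_ceil _
  · calc (⌈-Real.log (r a) / Real.log 2⌉₊ : ℝ) * Real.log 2
        ≤ (-Real.log (r a) / Real.log 2 + 1) * Real.log 2 := by
          gcongr
          exact (Nat.ceil_lt_add_one (hlog a)).le
      _ = -Real.log (r a) + Real.log 2 := by field_simp

/-- Mixing with the uniform distribution gives the atoms of mass zero a codeword as well. -/
lemma exists_kraft_mul_log_two_le_of_mem_stdSimplex [Nonempty α] (hq : q ∈ stdSimplex ℝ α) :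
    ∃ L : α → ℕ, Kraft L ∧
      ∀ a, 0 < q a → (L a : ℝ) * Real.log 2 ≤ -Real.log (q a) + 2 * Real.log 2 := by
  have hN : (0 : ℝ) < Fintype.card α := by exact_mod_cast Fintype.card_pos
  set r : α → ℝ := fun a => (q a + (Fintype.card α : ℝ)⁻¹) / 2
  have hr : ∀ a, 0 < r a := fun a =>
    div_pos (add_pos_of_nonneg_of_pos (hq.1 a) (inv_pos.2 hN)) two_pos
  have hr₁ : ∑ a, r a = 1 := by
    rw [← Finset.sum_div, Finset.sum_add_distrib, hq.2, Finset.sum_const, Finset.card_univ,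
      nsmul_eq_mul, mul_inv_cancel₀ hN.ne']
    norm_num
  obtain ⟨L, hL, hLr⟩ := exists_kraft_mul_log_two_le hr hr₁.le
  refine ⟨L, hL, fun a ha => (hLr a).trans ?_⟩
  have hle : Real.log (q a / 2) ≤ Real.log (r a) := by
    refine Real.log_le_log (by positivity) ?_
    change q a / 2 ≤ (q a + (Fintype.card α : ℝ)⁻¹) / 2
    gcongr
    exact le_add_of_nonneg_right (inv_pos.2 hN).le
  rw [Real.log_div ha.ne' two_ne_zero] at hle
  linarith

lemma mul_min_le_add {l c : ℝ} (hθ : 0 ≤ θ) (hθρ : θ ≤ ρ) :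
    ρ * min l c ≤ θ * l + (ρ - θ) * c := by
  linarith [mul_le_mul_of_nonneg_left (min_le_left l c) hθ,
    mul_le_mul_of_nonneg_left (min_le_right l c) (sub_nonneg.2 hθρ)]

lemma mul_exp_neg_log_tilted (hp : p ∈ stdSimplex ℝ α) (hθ : 1 + θ ≠ 0) {a : α} (ha : 0 < p a) :
    p a * Real.exp (θ * -Real.log (tilted p θ a)) =
      Real.exp (θ * Real.log (tiltSum p θ)) * p a ^ (1 / (1 + θ)) := by
  nth_rw 1 [← Real.exp_log ha]
  rw [log_tilted hp θ ha, Real.rpow_def_of_pos ha, ← Real.exp_add, ← Real.exp_add]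
  congr 1
  field_simp
  ring

lemma exists_kraft_sum_mul_exp_le [Nonempty α] (hp : p ∈ stdSimplex ℝ α) (hθ : 0 ≤ θ)
    (hθρ : θ ≤ ρ) (c : ℝ) : ∃ L : α → ℕ, Kraft L ∧
      ∑ a, p a * Real.exp (ρ * min ((L a : ℝ) * Real.log 2) c) ≤
        Real.exp ((ρ - θ) * c + θ * (2 * Real.log 2) + (1 + θ) * Real.log (tiltSum p θ)) := by
  have hZ := tiltSum_pos hp θ
  obtain ⟨L, hL, hLt⟩ := exists_kraft_mul_log_two_le_of_mem_stdSimplex (tilted_mem_stdSimplex hp θ)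
  refine ⟨L, hL, ?_⟩
  set C := (ρ - θ) * c + θ * (2 * Real.log 2)
  have hterm : ∀ a, p a * Real.exp (ρ * min ((L a : ℝ) * Real.log 2) c) ≤
      Real.exp (C + θ * Real.log (tiltSum p θ)) * p a ^ (1 / (1 + θ)) := fun a => by
    rcases (hp.1 a).eq_or_lt' with ha | ha
    · rw [ha, zero_mul]
      exact mul_nonneg (Real.exp_pos _).le (Real.rpow_nonneg le_rfl _)
    have hexponent : ρ * min ((L a : ℝ) * Real.log 2) c ≤
        C + θ * -Real.log (tilted p θ a) := by
      have := mul_le_mul_of_nonneg_left (hLt a (div_pos (Real.rpow_pos_of_pos ha _) hZ)) hθ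
      linarith [mul_min_le_add (l := (L a : ℝ) * Real.log 2) (c := c) hθ hθρ]
    calc p a * Real.exp (ρ * min ((L a : ℝ) * Real.log 2) c)
        ≤ p a * Real.exp (C + θ * -Real.log (tilted p θ a)) := by gcongr
      _ = Real.exp (C + θ * Real.log (tiltSum p θ)) * p a ^ (1 / (1 + θ)) := by
        rw [Real.exp_add C, Real.exp_add C, mul_left_comm,
          mul_exp_neg_log_tilted hp (by positivity) ha, mul_assoc]
  calc ∑ a, p a * Real.exp (ρ * min ((L a : ℝ) * Real.log 2) c)
      ≤ Real.exp (C + θ * Real.log (tiltSum p θ)) * tiltSum p θ := by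
        rw [tiltSum, Finset.mul_sum]
        exact Finset.sum_le_sum fun a _ => hterm a
    _ = Real.exp (C + (1 + θ) * Real.log (tiltSum p θ)) := by
        nth_rw 2 [← Real.exp_log hZ]
        rw [← Real.exp_add]
        ring_nf

lemma sum_mul_exp_pos (hp : p ∈ stdSimplex ℝ α) (g : α → ℝ) :
    0 < ∑ a, p a * Real.exp (g a) := by
  obtain ⟨a, ha⟩ := exists_pos_of_mem_stdSimplex hp
  exact Finset.sum_pos' (fun b _ => mul_nonneg (hp.1 b) (Real.exp_pos _).le)
    ⟨a, Finset.mem_univ _, mul_pos ha (Real.exp_pos _)⟩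

lemma compressionExponent_le [Nonempty X] (hP : IsSource P) (R : ℝ) (hθ : 0 ≤ θ) (hθρ : θ ≤ ρ)
    {n : ℕ} (hn : 0 < n) : compressionExponent P R ρ n ≤
      (((ρ - θ) * R + tiltedExponent P θ n + 1 / (n : ℝ) * (θ * (2 * Real.log 2)) : ℝ) :
        EReal) := by
  have hn' : (0 : ℝ) < n := by exact_mod_cast hn
  obtain ⟨L, hL, hcost⟩ := exists_kraft_sum_mul_exp_le (hP n) hθ hθρ (n * R)
  refine iInf_le_of_le ⟨L, hL⟩ (EReal.coe_le_coe_iff.2 ?_)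
  rw [← Real.log_le_iff_le_exp (sum_mul_exp_pos (hP n) _)] at hcost
  refine (mul_le_mul_of_nonneg_left hcost (one_div_nonneg.2 hn'.le)).trans (le_of_eq ?_)
  rw [tiltedExponent]
  field_simp
  ring

lemma limsup_coe_add_le {ι : Type*} (l : Filter ι) [l.NeBot] (c : ℝ) (u : ι → EReal) :
    limsup (fun i => (c : EReal) + u i) l ≤ (c : EReal) + limsup u l := by
  have h := EReal.limsup_add_le (f := l) (u := fun _ => (c : EReal)) (v := u)
    (by simp [limsup_const]) (by simp [limsup_const])
  rwa [limsup_const] at h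

theorem upperExponent_le_generalUpperBound [Nonempty X] (hP : IsSource P) :
    upperExponent P R ρ ≤ generalUpperBound P R ρ := by
  refine le_iInf₂ fun θ hθ => ?_
  rw [iSup_upperTradeoff hP (by linarith [hθ.1])]
  refine le_trans (limsup_le_limsup_of_forall_pos fun ε hε => ?_) (limsup_coe_add_le _ _ _)
  filter_upwards [eventually_one_div_nat_mul_le (θ * (2 * Real.log 2)) hε,
    eventually_gt_atTop 0] with n hnε hn
  refine (compressionExponent_le hP R hθ.1 hθ.2 hn).trans ?_
  norm_cast
  linarith

end Achievability

/-! ### Irreducible nonnegative matrices -/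

section Perron

open scoped Matrix

variable {S : Type*} {A B : Matrix S S ℝ}

lemma forall_of_isIrreducible (hA : A.IsIrreducible) {P : S → Prop} {i : S} (hi : P i)
    (hstep : ∀ j k, P j → 0 < A j k → P k) (j : S) : P j := by
  let := A.toQuiver
  obtain ⟨path, -⟩ := hA.connected i j
  induction path with
  | nil => exact hi
  | cons _ edge ih => exact hstep _ _ ih edge.down

lemma exists_pos_apply (hA : A.IsIrreducible) (i : S) : ∃ j, 0 < A i j := by
  let := Aᵀ.toQuiver
  obtain ⟨path, hlength⟩ := hA.transpose.connected i i
  cases path with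
  | nil => simp at hlength
  | cons _ edge => exact ⟨_, edge.down⟩

lemma isIrreducible_of_pos_imp_pos (hA : A.IsIrreducible) (hB : ∀ i j, 0 ≤ B i j)
    (h : ∀ i j, 0 < A i j → 0 < B i j) : B.IsIrreducible := by
  refine ⟨hB, fun i j => ?_⟩
  obtain ⟨path, hlength⟩ := hA.connected i j
  suffices ∃ path' : @Quiver.Path S B.toQuiver i j,
      @Quiver.Path.length S B.toQuiver _ _ path' = @Quiver.Path.length S A.toQuiver _ _ path by
    obtain ⟨path', heq⟩ := this
    exact ⟨path', heq ▸ hlength⟩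
  clear hlength
  induction path with
  | nil => exact ⟨@Quiver.Path.nil S B.toQuiver i, rfl⟩
  | cons _ edge ih =>
    obtain ⟨path', heq⟩ := ih
    exact ⟨@Quiver.Path.cons S B.toQuiver _ _ _ path' ⟨h _ _ edge.down⟩, congrArg (· + 1) heq⟩

variable [Fintype S]

lemma mulVec_apply_pos (hA : ∀ i j, 0 < A i j) {x : S → ℝ} (hx : ∀ i, 0 ≤ x i)
    (hx' : ∃ j, 0 < x j) (i : S) : 0 < (A *ᵥ x) i := by
  obtain ⟨j, hj⟩ := hx'
  exact Finset.sum_pos' (fun k _ => mul_nonneg (hA i k).le (hx k))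
    ⟨j, Finset.mem_univ _, mul_pos (hA i j) hj⟩

lemma mulVec_eigenvector_pos (hA : A.IsIrreducible) {x : S → ℝ} {r : ℝ} (hx : x ∈ stdSimplex ℝ S)
    (hAx : A *ᵥ x = r • x) (i : S) : 0 < x i := by
  refine (hx.1 i).lt_of_ne' fun hi => ?_
  have hzero : ∀ j, x j = 0 := by
    refine forall_of_isIrreducible hA hi fun j k hj hjk => ?_
    have hsum := congrFun hAx j
    rw [Pi.smul_apply, hj, smul_zero, Matrix.mulVec, dotProduct,
      Finset.sum_eq_zero_iff_of_nonneg fun l _ => mul_nonneg (hA.nonneg j l) (hx.1 l)] at hsum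
    exact (mul_eq_zero.1 (hsum k (Finset.mem_univ k))).resolve_left hjk.ne'
  obtain ⟨a, ha⟩ := exists_pos_of_mem_stdSimplex hx
  exact ha.ne' (hzero a)

lemma exists_pos_commute (hA : A.IsIrreducible) :
    ∃ B : Matrix S S ℝ, A * B = B * A ∧ ∀ i j, 0 < B i j := by
  classical
  choose k _ hpos using (Matrix.isIrreducible_iff_exists_pow_pos hA.nonneg).1 hA
  obtain ⟨N, hN⟩ := (Set.finite_range fun ij : S × S => k ij.1 ij.2).bddAbove
  refine ⟨∑ m ∈ Finset.range (N + 1), A ^ m, ?_, fun i j => ?_⟩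
  · simp only [Finset.mul_sum, Finset.sum_mul, ← pow_succ, ← pow_succ']
  · rw [Matrix.sum_apply]
    exact Finset.sum_pos' (fun m _ => Matrix.pow_apply_nonneg hA.nonneg m i j)
      ⟨k i j, Finset.mem_range.2 (Nat.lt_succ_of_le (hN ⟨(i, j), rfl⟩)), hpos i j⟩

/-- The Collatz–Wielandt pairs of `A`: the `r ≥ 0` and probability vectors `x` with `r x ≤ A x`.
The Perron eigenvalue of an irreducible matrix is the largest such `r`. -/
def collatzWielandt (A : Matrix S S ℝ) : Set (ℝ × (S → ℝ)) :=
  {z | 0 ≤ z.1 ∧ z.2 ∈ stdSimplex ℝ S ∧ ∀ i, z.1 * z.2 i ≤ (A *ᵥ z.2) i}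

lemma le_sum_of_mem_collatzWielandt (hA : ∀ i j, 0 ≤ A i j) {z : ℝ × (S → ℝ)}
    (hz : z ∈ collatzWielandt A) : z.1 ≤ ∑ i, ∑ j, A i j := by
  obtain ⟨-, hx, hle⟩ := hz
  calc z.1 = ∑ i, z.1 * z.2 i := by rw [← Finset.mul_sum, hx.2, mul_one]
    _ ≤ ∑ i, (A *ᵥ z.2) i := Finset.sum_le_sum fun i _ => hle i
    _ ≤ ∑ i, ∑ j, A i j := Finset.sum_le_sum fun i _ => Finset.sum_le_sum fun j _ =>
      mul_le_of_le_one_right (hA i j)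
        (hx.2 ▸ Finset.single_le_sum (fun l _ => hx.1 l) (Finset.mem_univ j))

lemma isCompact_collatzWielandt (hA : ∀ i j, 0 ≤ A i j) : IsCompact (collatzWielandt A) := by
  have hclosed : IsClosed {z : ℝ × (S → ℝ) | ∀ i, z.1 * z.2 i ≤ (A *ᵥ z.2) i} := by
    simp only [Set.ofPred_forall]
    exact isClosed_iInter fun i => isClosed_le (by fun_prop)
      (by simp only [Matrix.mulVec, dotProduct]; fun_prop)
  refine ((isCompact_Icc (a := 0) (b := ∑ i, ∑ j, A i j)).prod
    (isCompact_stdSimplex ℝ S)).inter_right hclosed |>.of_isClosed_subset ?_ fun z hz =>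
      ⟨⟨⟨hz.1, le_sum_of_mem_collatzWielandt hA hz⟩, hz.2.1⟩, hz.2.2⟩
  exact (isClosed_le continuous_const continuous_fst).inter
    (((isClosed_stdSimplex ℝ S).preimage continuous_snd).inter hclosed)

lemma collatzWielandt_nonempty [Nonempty S] (hA : ∀ i j, 0 ≤ A i j) :
    (collatzWielandt A).Nonempty := by
  classical
  obtain ⟨s⟩ := ‹Nonempty S›
  have hs := single_mem_stdSimplex ℝ s
  refine ⟨(0, Pi.single s 1), le_rfl, hs, fun i => ?_⟩
  rw [zero_mul]
  exact Finset.sum_nonneg fun j _ => mul_nonneg (hA i j) (hs.1 j)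

lemma smul_mem_collatzWielandt [Nonempty S] {r : ℝ} (hr : 0 ≤ r) {y : S → ℝ}
    (hy : ∀ i, 0 < y i) (hle : ∀ i, r * y i ≤ (A *ᵥ y) i) :
    (r, (∑ i, y i)⁻¹ • y) ∈ collatzWielandt A := by
  have hsum : 0 < ∑ i, y i := Finset.sum_pos (fun i _ => hy i) Finset.univ_nonempty
  refine ⟨hr, ⟨fun i => (mul_pos (inv_pos.2 hsum) (hy i)).le, ?_⟩, fun i => ?_⟩
  · simp only [Pi.smul_apply, smul_eq_mul]
    rw [← Finset.mul_sum, inv_mul_cancel₀ hsum.ne']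
  · simp only [Matrix.mulVec_smul, Pi.smul_apply, smul_eq_mul]
    rw [mul_left_comm]
    exact mul_le_mul_of_nonneg_left (hle i) (inv_pos.2 hsum).le

lemma exists_lt_mem_collatzWielandt (hA : A.IsIrreducible) {r : ℝ} {x : S → ℝ}
    (hz : (r, x) ∈ collatzWielandt A) (hne : A *ᵥ x ≠ r • x) :
    ∃ z ∈ collatzWielandt A, r < z.1 := by
  obtain ⟨hr, hx, hle⟩ := hz
  obtain ⟨a, ha⟩ := exists_pos_of_mem_stdSimplex hx
  have : Nonempty S := ⟨a⟩
  -- A positive matrix commuting with `A` turns the defect `A x - r x ≥ 0` into a positive one.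
  obtain ⟨B, hAB, hB⟩ := exists_pos_commute hA
  set d := A *ᵥ x - r • x with hd_def
  have hd : ∀ i, 0 ≤ d i := fun i => sub_nonneg.2 (hle i)
  have hd' : ∃ j, 0 < d j := by
    by_contra! hc
    exact hne (sub_eq_zero.1 (funext fun i => le_antisymm (hc i) (hd i)))
  set y := B *ᵥ x
  have hy : ∀ i, 0 < y i := mulVec_apply_pos hB hx.1 ⟨a, ha⟩
  have hBd : ∀ i, 0 < (B *ᵥ d) i := mulVec_apply_pos hB hd hd'
  have hAy : A *ᵥ y = r • y + B *ᵥ d := by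
    simp only [y, hd_def, Matrix.mulVec_sub, Matrix.mulVec_smul, Matrix.mulVec_mulVec, hAB]
    abel
  obtain ⟨i₀, hi₀⟩ := Finite.exists_min fun i => (B *ᵥ d) i / y i
  have hε : 0 < (B *ᵥ d) i₀ / y i₀ := div_pos (hBd _) (hy _)
  refine ⟨_, smul_mem_collatzWielandt (r := r + (B *ᵥ d) i₀ / y i₀) (by positivity) hy
    fun i => ?_, lt_add_of_pos_right r hε⟩
  have := (le_div_iff₀ (hy i)).1 (hi₀ i)
  simp only [hAy, Pi.add_apply, Pi.smul_apply, smul_eq_mul]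
  linarith

theorem exists_pos_eigenvector [Nonempty S] (hA : A.IsIrreducible) :
    ∃ r : ℝ, 0 < r ∧ ∃ x : S → ℝ, (∀ i, 0 < x i) ∧ A *ᵥ x = r • x := by
  obtain ⟨⟨r, x⟩, hz, hmax⟩ := (isCompact_collatzWielandt hA.nonneg).exists_isMaxOn
    (collatzWielandt_nonempty hA.nonneg) continuous_fst.continuousOn
  have hAx : A *ᵥ x = r • x := by
    by_contra hne
    obtain ⟨z, hz', hlt⟩ := exists_lt_mem_collatzWielandt hA hz hne
    exact (hmax hz').not_gt hlt
  have hx := mulVec_eigenvector_pos hA hz.2.1 hAx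
  obtain ⟨s⟩ := ‹Nonempty S›
  obtain ⟨t, ht⟩ := exists_pos_apply hA s
  have hpos : 0 < (A *ᵥ x) s := Finset.sum_pos' (fun j _ => mul_nonneg (hA.nonneg s j) (hx j).le)
    ⟨t, Finset.mem_univ t, mul_pos ht (hx t)⟩
  rw [hAx] at hpos
  exact ⟨r, pos_of_mul_pos_left hpos (hx s).le, x, hx, hAx⟩

/-- `u` and `v` are positive left and right eigenvectors of `A` for the eigenvalue `r > 0`,
normalized by `u ⬝ v = 1`. -/
structure IsPerronTriple (A : Matrix S S ℝ) (r : ℝ) (u v : S → ℝ) : Prop where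
  eigenvalue_pos : 0 < r
  left_pos : ∀ i, 0 < u i
  right_pos : ∀ i, 0 < v i
  vecMul_eq : u ᵥ* A = r • u
  mulVec_eq : A *ᵥ v = r • v
  dotProduct_eq_one : u ⬝ᵥ v = 1

lemma exists_isPerronTriple_of_mulVec [Nonempty S] (hA : A.IsIrreducible) {r : ℝ} {v : S → ℝ}
    (hr : 0 < r) (hv : ∀ i, 0 < v i) (hAv : A *ᵥ v = r • v) : ∃ u, IsPerronTriple A r u v := by
  obtain ⟨r', -, u, hu, hAu⟩ := exists_pos_eigenvector hA.transpose
  rw [Matrix.mulVec_transpose] at hAu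
  have huv : 0 < u ⬝ᵥ v := Finset.sum_pos (fun i _ => mul_pos (hu i) (hv i)) Finset.univ_nonempty
  have hrr' : r' * (u ⬝ᵥ v) = r * (u ⬝ᵥ v) := by
    rw [← smul_eq_mul, ← smul_dotProduct, ← hAu, ← Matrix.dotProduct_mulVec, hAv,
      dotProduct_smul, smul_eq_mul]
  rw [mul_right_cancel₀ huv.ne' hrr'] at hAu
  refine ⟨(u ⬝ᵥ v)⁻¹ • u, hr, fun i => mul_pos (inv_pos.2 huv) (hu i), hv, ?_, hAv, ?_⟩
  · rw [Matrix.smul_vecMul, hAu, smul_comm]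
  · rw [smul_dotProduct, smul_eq_mul, inv_mul_cancel₀ huv.ne']

lemma exists_isPerronTriple [Nonempty S] (hA : A.IsIrreducible) :
    ∃ r u v, IsPerronTriple A r u v := by
  obtain ⟨r, hr, v, hv, hAv⟩ := exists_pos_eigenvector hA
  obtain ⟨u, h⟩ := exists_isPerronTriple_of_mulVec hA hr hv hAv
  exact ⟨r, u, v, h⟩

end Perron

/-! ### The single-letter functional -/

section SingleLetter

variable {S : Type*} [Fintype S] {Q Q' : S × S → ℝ}

lemma marginal_nonneg (hQ : 0 ≤ Q) (s : S) : 0 ≤ marginal Q s :=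
  Finset.sum_nonneg fun _ _ => hQ _

lemma eq_zero_of_marginal_eq_zero (hQ : 0 ≤ Q) {s : S} (h : marginal Q s = 0) (t : S) :
    Q (s, t) = 0 :=
  (Finset.sum_eq_zero_iff_of_nonneg (f := fun t => Q (s, t)) fun _ _ => hQ _).1 h t
    (Finset.mem_univ _)

lemma marginal_mem_stdSimplex (hQ : Q ∈ stdSimplex ℝ (S × S)) : marginal Q ∈ stdSimplex ℝ S :=
  ⟨marginal_nonneg hQ.1, by simp only [marginal, ← Fintype.sum_prod_type, hQ.2]⟩

lemma condDist_of_marginal_ne_zero {s : S} (h : marginal Q s ≠ 0) (t : S) :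
    condDist Q s t = Q (s, t) / marginal Q s :=
  if_pos h

lemma condDist_mem_stdSimplex (hQ : 0 ≤ Q) (s : S) : condDist Q s ∈ stdSimplex ℝ S := by
  have : Nonempty S := ⟨s⟩
  by_cases h : marginal Q s = 0
  · simp [condDist, h, stdSimplex]
  · refine ⟨fun t => ?_, ?_⟩
    · rw [condDist_of_marginal_ne_zero h]
      exact div_nonneg (hQ _) (marginal_nonneg hQ s)
    · simp only [condDist_of_marginal_ne_zero h]
      rw [← Finset.sum_div]
      exact div_self h

lemma marginal_mul_condDist (hQ : 0 ≤ Q) (s t : S) : marginal Q s * condDist Q s t = Q (s, t) := by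
  by_cases h : marginal Q s = 0
  · rw [h, zero_mul, eq_zero_of_marginal_eq_zero hQ h]
  · rw [condDist_of_marginal_ne_zero h, mul_div_cancel₀ _ h]

lemma sum_marginal_mul_sum_condDist_mul (hQ : 0 ≤ Q) (g : S → S → ℝ) :
    ∑ s, marginal Q s * ∑ t, condDist Q s t * g s t = ∑ z, Q z * g z.1 z.2 := by
  simp only [Finset.mul_sum, ← mul_assoc, marginal_mul_condDist hQ, Fintype.sum_prod_type]

lemma absCont_condDist (hQ : 0 ≤ Q) {s : S} (hs : marginal Q s ≠ 0) {k : S → ℝ} :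
    AbsCont (condDist Q s) k ↔ ∀ t, k t = 0 → Q (s, t) = 0 := by
  refine forall₂_congr fun t _ => ?_
  rw [← marginal_mul_condDist hQ, mul_eq_zero, or_iff_right hs]

lemma condEntropy_eq_neg_sum (hQ : 0 ≤ Q) :
    condEntropy Q = -∑ z, Q z * Real.log (condDist Q z.1 z.2) := by
  simp only [condEntropy, entropy_eq_neg_sum, mul_neg, Finset.sum_neg_distrib]
  rw [sum_marginal_mul_sum_condDist_mul hQ fun s t => Real.log (condDist Q s t)]

lemma condEntropy_eq_sub (hQ : 0 ≤ Q) :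
    condEntropy Q = ∑ z, Real.negMulLog (Q z) - ∑ s, Real.negMulLog (marginal Q s) := by
  rw [Fintype.sum_prod_type, condEntropy, ← Finset.sum_sub_distrib]
  refine Finset.sum_congr rfl fun s _ => ?_
  simp only [← marginal_mul_condDist hQ s, Real.negMulLog_mul, Finset.sum_add_distrib,
    ← Finset.sum_mul, ← Finset.mul_sum, (condDist_mem_stdSimplex hQ s).2, one_mul, entropy]
  ring

lemma condEntropy_le_neg_sum (hQ : 0 ≤ Q) {K : S → S → ℝ} (hK : ∀ s, K s ∈ stdSimplex ℝ S)
    (h : ∀ s t, K s t = 0 → Q (s, t) = 0) :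
    condEntropy Q ≤ -∑ z, Q z * Real.log (K z.1 z.2) := by
  rw [← sum_marginal_mul_sum_condDist_mul hQ fun s t => Real.log (K s t), condEntropy,
    ← Finset.sum_neg_distrib]
  refine Finset.sum_le_sum fun s _ => ?_
  by_cases hs : marginal Q s = 0
  · simp [hs]
  rw [← mul_neg]
  exact mul_le_mul_of_nonneg_left (le_neg.2 (sum_mul_log_le_neg_entropy
    (condDist_mem_stdSimplex hQ s) (hK s).1 (hK s).2.le ((absCont_condDist hQ hs).2 (h s))))
    (marginal_nonneg hQ s)

lemma condEntropy_smul {a : ℝ} (ha : 0 ≤ a) (hQ : 0 ≤ Q) :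
    condEntropy (a • Q) = a * condEntropy Q := by
  have hmarginal : ∀ s, marginal (a • Q) s = a * marginal Q s := fun s => by
    simp only [marginal, Pi.smul_apply, smul_eq_mul, Finset.mul_sum]
  have htotal : ∑ s, marginal Q s = ∑ z, Q z := (Fintype.sum_prod_type Q).symm
  rw [condEntropy_eq_sub (smul_nonneg ha hQ), condEntropy_eq_sub hQ]
  simp only [hmarginal, Pi.smul_apply, smul_eq_mul, Real.negMulLog_mul, Finset.sum_add_distrib,
    ← Finset.sum_mul, ← Finset.mul_sum, htotal]
  ring

lemma condEntropy_add_le (hQ : 0 ≤ Q) (hQ' : 0 ≤ Q') :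
    condEntropy Q + condEntropy Q' ≤ condEntropy (Q + Q') := by
  have hsum : 0 ≤ Q + Q' := add_nonneg hQ hQ'
  have hzero : ∀ s t, condDist (Q + Q') s t = 0 → Q (s, t) = 0 ∧ Q' (s, t) = 0 := fun s t h =>
    (add_eq_zero_iff_of_nonneg (hQ _) (hQ' _)).1 (by
      rw [← Pi.add_apply, ← marginal_mul_condDist hsum, h, mul_zero])
  have hK := condDist_mem_stdSimplex hsum
  refine (add_le_add (condEntropy_le_neg_sum hQ hK fun s t h => (hzero s t h).1)
    (condEntropy_le_neg_sum hQ' hK fun s t h => (hzero s t h).2)).trans_eq ?_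
  simp only [condEntropy_eq_neg_sum hsum, Pi.add_apply, add_mul, Finset.sum_add_distrib, neg_add]

lemma concaveOn_condEntropy : ConcaveOn ℝ (Set.Ici (0 : S × S → ℝ)) condEntropy := by
  refine ⟨convex_Ici 0, fun Q hQ Q' hQ' a b ha hb _ => ?_⟩
  rw [smul_eq_mul, smul_eq_mul, ← condEntropy_smul ha hQ, ← condEntropy_smul hb hQ']
  exact condEntropy_add_le (smul_nonneg ha hQ) (smul_nonneg hb hQ')

lemma continuousOn_condEntropy : ContinuousOn condEntropy (Set.Ici (0 : S × S → ℝ)) := by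
  have hcont : Continuous fun Q : S × S → ℝ =>
      ∑ z, Real.negMulLog (Q z) - ∑ s, Real.negMulLog (marginal Q s) := by
    simp only [marginal]
    have := Real.continuous_negMulLog
    fun_prop
  exact hcont.continuousOn.congr fun Q hQ => condEntropy_eq_sub hQ

/-- The stationary pair distributions that are absolutely continuous with respect to `π`, i.e.
those with `D(η ‖ π | q) < ∞`. -/
def admissiblePairs (π : Matrix S S ℝ) : Set (S × S → ℝ) :=
  stationaryPairs S ∩ {Q | ∀ s t, π s t = 0 → Q (s, t) = 0}

/-- The value of `θ H(η | q) - D(η ‖ π | q)` at an admissible pair distribution. -/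
noncomputable def pairTradeoff (π : Matrix S S ℝ) (θ : ℝ) (Q : S × S → ℝ) : ℝ :=
  (1 + θ) * condEntropy Q + ∑ z, Q z * Real.log (π z.1 z.2)

/-- The value of `ρ min {H(η | q), R} - D(η ‖ π | q)` at an admissible pair distribution. -/
noncomputable def pairValue (π : Matrix S S ℝ) (R ρ : ℝ) (Q : S × S → ℝ) : ℝ :=
  ρ * min (condEntropy Q) R + pairTradeoff π 0 Q

variable {π : Matrix S S ℝ} {θ R ρ : ℝ}

lemma nonneg_of_mem_admissiblePairs (hQ : Q ∈ admissiblePairs π) : 0 ≤ Q :=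
  hQ.1.1.1

lemma convex_admissiblePairs (π : Matrix S S ℝ) : Convex ℝ (admissiblePairs π) := by
  intro Q hQ Q' hQ' a b ha hb hab
  refine ⟨⟨convex_stdSimplex ℝ _ hQ.1.1 hQ'.1.1 ha hb hab, fun s => ?_⟩, fun s t h => ?_⟩
  · simp only [Pi.add_apply, Pi.smul_apply, smul_eq_mul, Finset.sum_add_distrib,
      ← Finset.mul_sum, hQ.1.2, hQ'.1.2]
  · simp [hQ.2 s t h, hQ'.2 s t h]

lemma isCompact_admissiblePairs (π : Matrix S S ℝ) : IsCompact (admissiblePairs π) := by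
  have hinter : admissiblePairs π = stdSimplex ℝ (S × S) ∩
      ({Q | ∀ s, ∑ t, Q (t, s) = ∑ t, Q (s, t)} ∩ {Q | ∀ s t, π s t = 0 → Q (s, t) = 0}) :=
    Set.ext fun _ => and_assoc
  rw [hinter]
  refine (isCompact_stdSimplex ℝ _).inter_right (IsClosed.inter ?_ ?_)
  · simp only [Set.ofPred_forall]
    exact isClosed_iInter fun s => isClosed_eq (by fun_prop) (by fun_prop)
  · simp only [Set.ofPred_forall]
    exact isClosed_iInter fun s => isClosed_iInter fun t => isClosed_iInter fun _ =>
      isClosed_eq (by fun_prop) continuous_const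

lemma concaveOn_pairTradeoff (π : Matrix S S ℝ) (hθ : 0 ≤ 1 + θ) :
    ConcaveOn ℝ (Set.Ici 0) (pairTradeoff π θ) := by
  refine (concaveOn_condEntropy.smul hθ).add ⟨convex_Ici 0, fun Q _ Q' _ a b _ _ _ => ?_⟩
  simp only [Pi.add_apply, Pi.smul_apply, smul_eq_mul, add_mul, mul_assoc,
    Finset.sum_add_distrib, Finset.mul_sum, le_refl]

lemma continuousOn_pairTradeoff (π : Matrix S S ℝ) (θ : ℝ) :
    ContinuousOn (pairTradeoff π θ) (Set.Ici 0) :=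
  (continuousOn_condEntropy.const_mul _).add (by fun_prop)

lemma continuousOn_pairValue (π : Matrix S S ℝ) (R ρ : ℝ) :
    ContinuousOn (pairValue π R ρ) (Set.Ici 0) :=
  (continuousOn_const.mul (continuousOn_condEntropy.inf continuousOn_const)).add
    (continuousOn_pairTradeoff π 0)

lemma pairTradeoff_eq_mul_condEntropy_add (π : Matrix S S ℝ) (θ : ℝ) (Q : S × S → ℝ) :
    pairTradeoff π θ Q = θ * condEntropy Q + pairTradeoff π 0 Q := by
  simp only [pairTradeoff]
  ring

lemma exists_pairTradeoff_le_pairValue (hne : (admissiblePairs π).Nonempty) (R : ℝ)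
    (hρ : 0 ≤ ρ) : ∃ θ ∈ Set.Icc 0 ρ, ∃ Q ∈ admissiblePairs π, ∀ Q' ∈ admissiblePairs π,
      (ρ - θ) * R + pairTradeoff π θ Q' ≤ pairValue π R ρ Q := by
  have hsub : admissiblePairs π ⊆ Set.Ici 0 := fun Q => nonneg_of_mem_admissiblePairs
  obtain ⟨θ, hθ, Q, hQ, hsaddle⟩ := Sion.exists_isSaddlePointOn (X := Set.Icc (0 : ℝ) ρ)
    (Y := admissiblePairs π) (f := fun θ Q => (ρ - θ) * R + pairTradeoff π θ Q)
    ⟨0, le_rfl, hρ⟩ (convex_Icc _ _) isCompact_Icc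
    (fun Q _ => by
      refine ContinuousOn.lowerSemicontinuousOn (Continuous.continuousOn ?_)
      simp only [pairTradeoff]
      fun_prop)
    (fun Q _ => by
      refine ConvexOn.quasiconvexOn ⟨convex_Icc _ _, fun x _ y _ a b _ _ hab => le_of_eq ?_⟩
      simp only [pairTradeoff, smul_eq_mul]
      linear_combination (-(ρ * R) - condEntropy Q - ∑ z, Q z * Real.log (π z.1 z.2)) * hab)
    (convex_admissiblePairs π) hne (isCompact_admissiblePairs π)
    (fun θ _ => ContinuousOn.upperSemicontinuousOn
      (continuousOn_const.add ((continuousOn_pairTradeoff π θ).mono hsub)))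
    (fun θ hθ => ((concaveOn_const _ (convex_admissiblePairs π)).add
      ((concaveOn_pairTradeoff π (add_nonneg zero_le_one hθ.1)).subset hsub
        (convex_admissiblePairs π))).quasiconcaveOn)
  refine ⟨θ, hθ, Q, hQ, fun Q' hQ' => ?_⟩
  -- `ρ min {H, R}` is the smaller of the values of `(ρ - θ) R + θ H` at `θ = 0` and `θ = ρ`.
  rw [pairValue]
  rcases le_total (condEntropy Q) R with hR | hR
  · refine (hsaddle ρ ⟨hρ, le_rfl⟩ Q' hQ').trans_eq ?_
    simp only [min_eq_left hR, sub_self, zero_mul, zero_add]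
    exact pairTradeoff_eq_mul_condEntropy_add π ρ Q
  · refine (hsaddle 0 ⟨le_rfl, hρ⟩ Q' hQ').trans_eq ?_
    simp only [min_eq_right hR, sub_zero]

lemma coe_sum_eq_sum_coe {ι : Type*} (s : Finset ι) (f : ι → ℝ) :
    ((∑ i ∈ s, f i : ℝ) : EReal) = ∑ i ∈ s, (f i : EReal) :=
  map_sum (⟨⟨Real.toEReal, rfl⟩, EReal.coe_add⟩ : ℝ →+ EReal) f s

lemma sum_eq_top_of_mem {ι : Type*} {s : Finset ι} {f : ι → EReal} (h : ∀ i ∈ s, f i ≠ ⊥)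
    {i : ι} (hi : i ∈ s) (hf : f i = ⊤) : ∑ i ∈ s, f i = ⊤ := by
  classical
  rw [← Finset.add_sum_erase s f hi, hf]
  refine EReal.top_add_of_ne_bot (Finset.sum_induction f (· ≠ ⊥) (fun a b ha hb => ?_)
    EReal.zero_ne_bot fun j hj => h j (Finset.mem_of_mem_erase hj))
  simpa only [ne_eq, EReal.add_eq_bot_iff, not_or] using And.intro ha hb

lemma condDivergence_of_absCont (hQ : 0 ≤ Q) (h : ∀ s t, π s t = 0 → Q (s, t) = 0) :
    condDivergence Q π = ((-pairTradeoff π 0 Q : ℝ) : EReal) := by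
  have hrow : ∀ s, (marginal Q s : EReal) * divergence (condDist Q s) (π s) =
      ((marginal Q s * klSum (condDist Q s) (π s) : ℝ) : EReal) := fun s => by
    by_cases hs : marginal Q s = 0
    · simp [hs]
    · rw [divergence_of_absCont ((absCont_condDist hQ hs).2 (h s)), EReal.coe_mul]
  simp only [condDivergence, hrow]
  rw [← coe_sum_eq_sum_coe]
  simp only [klSum_eq_neg_entropy_sub, mul_sub, mul_neg, Finset.sum_sub_distrib,
    Finset.sum_neg_distrib]
  rw [sum_marginal_mul_sum_condDist_mul hQ fun s t => Real.log (π s t), ← condEntropy,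
    pairTradeoff, add_zero, one_mul, neg_add']

lemma condDivergence_of_not_absCont (hQ : 0 ≤ Q) {s t : S} (hπ : π s t = 0)
    (hst : Q (s, t) ≠ 0) : condDivergence Q π = ⊤ := by
  have hs : marginal Q s ≠ 0 := fun hs => hst (eq_zero_of_marginal_eq_zero hQ hs t)
  refine sum_eq_top_of_mem (i := s) (fun s _ => ?_) (Finset.mem_univ s) ?_
  · by_cases hac : AbsCont (condDist Q s) (π s)
    · rw [divergence_of_absCont hac, ← EReal.coe_mul]
      exact EReal.coe_ne_bot _
    · rw [divergence_of_not_absCont hac]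
      exact (EReal.mul_nonneg (EReal.coe_nonneg.2 (marginal_nonneg hQ s)) le_top).trans_lt'
        EReal.bot_lt_zero |>.ne'
  · rw [divergence_of_not_absCont fun hac => hst ((absCont_condDist hQ hs).1 hac t hπ),
      EReal.coe_mul_top_of_pos ((marginal_nonneg hQ s).lt_of_ne' hs)]

theorem markovExponent_eq_iSup_pairValue (π : Matrix S S ℝ) (R ρ : ℝ) :
    markovExponent π R ρ = ⨆ Q ∈ admissiblePairs π, (pairValue π R ρ Q : EReal) := by
  have hval : ∀ Q ∈ admissiblePairs π, ((ρ * min (condEntropy Q) R : ℝ) : EReal) -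
      condDivergence Q π = (pairValue π R ρ Q : EReal) := fun Q hQ => by
    rw [condDivergence_of_absCont (nonneg_of_mem_admissiblePairs hQ) hQ.2, ← EReal.coe_sub,
      sub_neg_eq_add, pairValue]
  refine le_antisymm (iSup₂_le fun Q hQ => ?_) (iSup₂_mono' fun Q hQ => ⟨Q, hQ.1, (hval Q hQ).ge⟩)
  by_cases hac : ∀ s t, π s t = 0 → Q (s, t) = 0
  · rw [hval Q ⟨hQ, hac⟩]
    exact le_iSup₂ (f := fun Q (_ : Q ∈ admissiblePairs π) => (pairValue π R ρ Q : EReal))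
      Q ⟨hQ, hac⟩
  · push Not at hac
    obtain ⟨s, t, hπ, hst⟩ := hac
    rw [condDivergence_of_not_absCont hQ.1.1 hπ hst, EReal.sub_top]
    exact bot_le

end SingleLetter

/-! ### Sums over paths -/

section Paths

open scoped Matrix

variable {S X : Type*} {A : Matrix S S ℝ} {p : S → ℝ}

/-- The sum of `g` over the transitions of a path. -/
def pathSum (g : S → S → ℝ) {m : ℕ} (x : Fin (m + 1) → S) : ℝ :=
  ∑ i : Fin m, g (x i.castSucc) (x i.succ)

lemma pathSum_init (g : S → S → ℝ) {m : ℕ} (x : Fin (m + 2) → S) :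
    pathSum g x = pathSum g (Fin.init x) + g (Fin.init x (Fin.last m)) (x (Fin.last (m + 1))) :=
  Fin.sum_univ_castSucc _

lemma markovLaw_init (p : S → ℝ) (A : Matrix S S ℝ) {m : ℕ} (x : Fin (m + 2) → S) :
    markovLaw p A (m + 2) x = markovLaw p A (m + 1) (Fin.init x) *
      A (Fin.init x (Fin.last m)) (x (Fin.last (m + 1))) := by
  rw [markovLaw, Fin.prod_univ_castSucc, ← mul_assoc]
  rfl

lemma markovLaw_nonneg (hp : ∀ s, 0 ≤ p s) (hA : ∀ s t, 0 ≤ A s t) (n : ℕ) (x : Fin n → S) :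
    0 ≤ markovLaw p A n x := by
  cases n with
  | zero => exact zero_le_one
  | succ n => exact mul_nonneg (hp _) (Finset.prod_nonneg fun _ _ => hA _ _)

lemma markovLaw_rpow (hp : ∀ s, 0 ≤ p s) (hA : ∀ s t, 0 ≤ A s t) (a : ℝ) (n : ℕ)
    (x : Fin n → S) :
    markovLaw p A n x ^ a = markovLaw (fun s => p s ^ a) (A.map (· ^ a)) n x := by
  cases n with
  | zero => exact Real.one_rpow a
  | succ n =>
    rw [markovLaw, Real.mul_rpow (hp _) (Finset.prod_nonneg fun _ _ => hA _ _),
      ← Real.finsetProd_rpow _ _ fun _ _ => hA _ _]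
    rfl

variable [Fintype S]

lemma sum_markovLaw_one_mul (p : S → ℝ) (A : Matrix S S ℝ) (F : S → ℝ) :
    ∑ x, markovLaw p A 1 x * F (x 0) = ∑ s, p s * F s := by
  rw [← (Equiv.funUnique (Fin 1) S).symm.sum_comp]
  simp [markovLaw]

lemma sum_markovLaw_mul_init (p : S → ℝ) (A : Matrix S S ℝ) (m : ℕ)
    (F : (Fin (m + 1) → S) → S → ℝ) :
    ∑ x, markovLaw p A (m + 2) x * F (Fin.init x) (x (Fin.last (m + 1))) =
      ∑ y, markovLaw p A (m + 1) y * ∑ t, A (y (Fin.last m)) t * F y t := by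
  have hinit : ∀ (y : Fin (m + 1) → S) t, Fin.init (Fin.snocEquiv (fun _ => S) (t, y)) = y :=
    fun y t => Fin.init_snoc (α := fun _ => S) t y
  rw [← (Fin.snocEquiv fun _ : Fin (m + 2) => S).sum_comp, Fintype.sum_prod_type_right]
  simp only [markovLaw_init, hinit, Fin.snocEquiv_apply, Fin.snoc_last, mul_assoc, Finset.mul_sum]

lemma sum_markovLaw_mul_eigenvector {v : S → ℝ} {r : ℝ} (h : A *ᵥ v = r • v) (p : S → ℝ) (m : ℕ) :
    ∑ x, markovLaw p A (m + 1) x * v (x (Fin.last m)) = r ^ m * (p ⬝ᵥ v) := by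
  induction m with
  | zero => rw [pow_zero, one_mul]; exact sum_markovLaw_one_mul p A v
  | succ m ih =>
    have hrow : ∀ s, ∑ t, A s t * v t = r * v s := congrFun h
    rw [sum_markovLaw_mul_init p A m fun _ => v, pow_succ', mul_assoc, ← ih, Finset.mul_sum]
    simp only [hrow, mul_left_comm]

lemma isSource_markovLaw (hp : p ∈ stdSimplex ℝ S) (hA : ∀ s, A s ∈ stdSimplex ℝ S) :
    IsSource (markovLaw p A) := fun n => by
  refine ⟨markovLaw_nonneg hp.1 (fun s => (hA s).1) n, ?_⟩
  cases n with
  | zero => simp [markovLaw]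
  | succ n =>
    have hone : A *ᵥ (1 : S → ℝ) = (1 : ℝ) • 1 := by
      ext s
      simp [Matrix.mulVec, dotProduct, (hA s).2]
    simpa [dotProduct, hp.2] using sum_markovLaw_mul_eigenvector hone p n

variable [Fintype X]

lemma sum_outputLaw_mul (p : S → ℝ) (A : Matrix S S ℝ) (f : S → X) {n : ℕ}
    (φ : (Fin n → X) → ℝ) :
    ∑ x, outputLaw p A f n x * φ x = ∑ s, markovLaw p A n s * φ (f ∘ s) := by
  classical
  rw [← Finset.sum_fiberwise Finset.univ (fun s : Fin n → S => f ∘ s)]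
  refine Finset.sum_congr rfl fun x _ => ?_
  rw [outputLaw, Finset.sum_mul]
  refine Finset.sum_congr (by congr!) fun s hs => ?_
  rw [(Finset.mem_filter.1 hs).2]

lemma isSource_outputLaw (hp : p ∈ stdSimplex ℝ S) (hA : ∀ s, A s ∈ stdSimplex ℝ S) (f : S → X) :
    IsSource (outputLaw p A f) := fun n =>
  ⟨fun _ => Finset.sum_nonneg fun s _ => (isSource_markovLaw hp hA n).1 s, by
    simpa [(isSource_markovLaw hp hA n).2] using sum_outputLaw_mul p A f (n := n) 1⟩

end Paths

/-! ### The upper bound for hidden Markov sources -/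

section Gibbs

variable {S X : Type*} [Fintype S] [Fintype X] {A π : Matrix S S ℝ} {Q : S × S → ℝ}
  {p u v : S → ℝ} {r θ R ρ : ℝ}

lemma sum_mul_apply_snd_eq_sum_mul_apply_fst (hQ : Q ∈ stationaryPairs S) (g : S → ℝ) :
    ∑ z, Q z * g z.2 = ∑ z, Q z * g z.1 := by
  rw [Fintype.sum_prod_type, Finset.sum_comm, Fintype.sum_prod_type]
  simp only [← Finset.sum_mul, hQ.2]

/-- The pair distribution of the stationary Markov chain with transition probabilities
`A s t * v t / (r * v s)`, where `u`, `v` are Perron eigenvectors of `A` for the eigenvalue `r`. It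
maximizes `H(η | q) + ∑ z, Q z * log (A z.1 z.2)`. -/
noncomputable def gibbsPair (A : Matrix S S ℝ) (r : ℝ) (u v : S → ℝ) (z : S × S) : ℝ :=
  u z.1 * A z.1 z.2 * v z.2 / r

lemma gibbsPair_nonneg (h : IsPerronTriple A r u v) (hA : ∀ s t, 0 ≤ A s t) :
    0 ≤ gibbsPair A r u v := fun _ =>
  div_nonneg (mul_nonneg (mul_nonneg (h.left_pos _).le (hA _ _)) (h.right_pos _).le)
    h.eigenvalue_pos.le

lemma gibbsPair_pos (h : IsPerronTriple A r u v) {s t : S} (hst : 0 < A s t) :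
    0 < gibbsPair A r u v (s, t) :=
  div_pos (mul_pos (mul_pos (h.left_pos s) hst) (h.right_pos t)) h.eigenvalue_pos

lemma marginal_gibbsPair (h : IsPerronTriple A r u v) (s : S) :
    marginal (gibbsPair A r u v) s = u s * v s := by
  have hrow : ∑ t, A s t * v t = r * v s := congrFun h.mulVec_eq s
  simp only [marginal, gibbsPair, mul_assoc, ← Finset.sum_div, ← Finset.mul_sum, hrow]
  rw [mul_left_comm, mul_div_cancel_left₀ _ h.eigenvalue_pos.ne']

lemma sum_gibbsPair_fst (h : IsPerronTriple A r u v) (t : S) :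
    ∑ s, gibbsPair A r u v (s, t) = u t * v t := by
  have hcol : ∑ s, u s * A s t = r * u t := congrFun h.vecMul_eq t
  simp only [gibbsPair, ← Finset.sum_div, ← Finset.sum_mul, hcol]
  rw [mul_assoc, mul_div_cancel_left₀ _ h.eigenvalue_pos.ne']

lemma gibbsPair_mem_stationaryPairs (h : IsPerronTriple A r u v) (hA : ∀ s t, 0 ≤ A s t) :
    gibbsPair A r u v ∈ stationaryPairs S := by
  refine ⟨⟨gibbsPair_nonneg h hA, ?_⟩, fun s => ?_⟩
  · rw [Fintype.sum_prod_type, ← h.dotProduct_eq_one]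
    exact Finset.sum_congr rfl fun s _ => marginal_gibbsPair h s
  · rw [sum_gibbsPair_fst h]
    exact (marginal_gibbsPair h s).symm

lemma condDist_gibbsPair (h : IsPerronTriple A r u v) (s t : S) :
    condDist (gibbsPair A r u v) s t = A s t * v t / (r * v s) := by
  have hu := h.left_pos s
  have hv := h.right_pos s
  have hr := h.eigenvalue_pos
  have hs : marginal (gibbsPair A r u v) s = u s * v s := marginal_gibbsPair h s
  rw [condDist_of_marginal_ne_zero (by rw [hs]; positivity), hs, gibbsPair]
  field_simp

lemma condEntropy_gibbsPair_add (h : IsPerronTriple A r u v) (hA : ∀ s t, 0 ≤ A s t) :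
    condEntropy (gibbsPair A r u v) + ∑ z, gibbsPair A r u v z * Real.log (A z.1 z.2) =
      Real.log r := by
  have hQ := gibbsPair_mem_stationaryPairs h hA
  have hlog : ∀ z, gibbsPair A r u v z * Real.log (condDist (gibbsPair A r u v) z.1 z.2) =
      gibbsPair A r u v z * Real.log (A z.1 z.2) + gibbsPair A r u v z * Real.log (v z.2) -
        gibbsPair A r u v z * Real.log (v z.1) - gibbsPair A r u v z * Real.log r := fun z => by
    rcases eq_or_ne (A z.1 z.2) 0 with hz | hz
    · simp [gibbsPair, hz]
    · have hr := h.eigenvalue_pos.ne'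
      have hv := fun s => (h.right_pos s).ne'
      rw [condDist_gibbsPair h, Real.log_div (mul_ne_zero hz (hv _)) (mul_ne_zero hr (hv _)),
        Real.log_mul hz (hv _), Real.log_mul hr (hv _)]
      ring
  rw [condEntropy_eq_neg_sum hQ.1.1]
  simp only [hlog, Finset.sum_sub_distrib, Finset.sum_add_distrib, ← Finset.sum_mul, hQ.1.2,
    sum_mul_apply_snd_eq_sum_mul_apply_fst hQ fun s => Real.log (v s)]
  ring

/-- The entrywise power `π ^ (1 / (1 + θ))`, the transfer matrix of the tilted path laws. -/
noncomputable def tiltedMatrix (π : Matrix S S ℝ) (θ : ℝ) : Matrix S S ℝ :=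
  π.map (· ^ (1 / (1 + θ)))

omit [Fintype S] in
lemma isIrreducible_tiltedMatrix (hπ : π.IsIrreducible) (θ : ℝ) :
    (tiltedMatrix π θ).IsIrreducible :=
  isIrreducible_of_pos_imp_pos hπ (fun s t => Real.rpow_nonneg (hπ.nonneg s t) _)
    fun _ _ h => Real.rpow_pos_of_pos h _

lemma gibbsPair_tiltedMatrix_mem_admissiblePairs (hπ : π.IsIrreducible) (hθ : 1 + θ ≠ 0)
    (h : IsPerronTriple (tiltedMatrix π θ) r u v) :
    gibbsPair (tiltedMatrix π θ) r u v ∈ admissiblePairs π :=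
  ⟨gibbsPair_mem_stationaryPairs h (isIrreducible_tiltedMatrix hπ θ).nonneg, fun s t hst => by
    simp [gibbsPair, tiltedMatrix, hst, hθ]⟩

lemma pairTradeoff_gibbsPair_tiltedMatrix (hπ : π.IsIrreducible) (hθ : 1 + θ ≠ 0)
    (h : IsPerronTriple (tiltedMatrix π θ) r u v) :
    pairTradeoff π θ (gibbsPair (tiltedMatrix π θ) r u v) = (1 + θ) * Real.log r := by
  have hlog : ∀ z : S × S, gibbsPair (tiltedMatrix π θ) r u v z * Real.log (π z.1 z.2) =
      (1 + θ) * (gibbsPair (tiltedMatrix π θ) r u v z *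
        Real.log (tiltedMatrix π θ z.1 z.2)) := fun z => by
    rcases (hπ.nonneg z.1 z.2).eq_or_lt with hz | hz
    · simp [gibbsPair, tiltedMatrix, ← hz, hθ]
    · rw [tiltedMatrix, Matrix.map_apply, Real.log_rpow hz]
      field_simp
  simp only [pairTradeoff, hlog]
  rw [← Finset.mul_sum, ← mul_add,
    condEntropy_gibbsPair_add h (isIrreducible_tiltedMatrix hπ θ).nonneg]

lemma exists_mem_admissiblePairs_pos [Nonempty S] (hπ : π.IsIrreducible) :
    ∃ Q ∈ admissiblePairs π, ∀ s t, 0 < π s t → 0 < Q (s, t) := by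
  obtain ⟨r, u, v, h⟩ := exists_isPerronTriple (isIrreducible_tiltedMatrix hπ 0)
  exact ⟨_, gibbsPair_tiltedMatrix_mem_admissiblePairs hπ (by norm_num) h,
    fun s t hst => gibbsPair_pos h (Real.rpow_pos_of_pos hst _)⟩

lemma rpow_sum_le_sum_rpow {ι : Type*} (s : Finset ι) {f : ι → ℝ} (hf : ∀ i ∈ s, 0 ≤ f i) {a : ℝ}
    (ha : 0 < a) (ha₁ : a ≤ 1) : (∑ i ∈ s, f i) ^ a ≤ ∑ i ∈ s, f i ^ a :=
  Finset.le_sum_of_subadditive_on_pred (· ^ a) (0 ≤ ·) (Real.zero_rpow ha.ne').le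
    (fun _ _ hx hy => Real.rpow_add_le_add_rpow hx hy ha.le ha₁) (fun _ _ => add_nonneg) f hf

lemma tiltSum_outputLaw_le (hp : ∀ s, 0 ≤ p s) (hA : ∀ s t, 0 ≤ A s t) (f : S → X) (hθ : 0 ≤ θ)
    (n : ℕ) : tiltSum (outputLaw p A f n) θ ≤ tiltSum (markovLaw p A n) θ := by
  classical
  have hθ₁ : 0 < 1 + θ := by positivity
  rw [tiltSum, tiltSum, ← Finset.sum_fiberwise Finset.univ (fun s : Fin n → S => f ∘ s)]
  refine Finset.sum_le_sum fun x _ => ?_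
  rw [outputLaw]
  convert rpow_sum_le_sum_rpow _ (fun s _ => markovLaw_nonneg hp hA n s) (one_div_pos.2 hθ₁)
    ((div_le_one hθ₁).2 (le_add_of_nonneg_right hθ))

lemma exists_tiltSum_markovLaw_le [Nonempty S] (hp : ∀ s, 0 ≤ p s) (hA : ∀ s t, 0 ≤ A s t)
    (h : IsPerronTriple (tiltedMatrix A θ) r u v) :
    ∃ C, ∀ m, tiltSum (markovLaw p A (m + 1)) θ ≤ r ^ m * C := by
  obtain ⟨s₀, hs₀⟩ := Finite.exists_min v
  set a := 1 / (1 + θ)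
  refine ⟨((fun s => p s ^ a) ⬝ᵥ v) / v s₀, fun m => ?_⟩
  rw [← mul_div_assoc, le_div_iff₀ (h.right_pos s₀),
    ← sum_markovLaw_mul_eigenvector h.mulVec_eq, tiltSum, Finset.sum_mul]
  refine Finset.sum_le_sum fun x _ => ?_
  rw [markovLaw_rpow hp hA]
  exact mul_le_mul_of_nonneg_left (hs₀ _) (markovLaw_nonneg (fun s => Real.rpow_nonneg (hp s) _)
    (fun s t => Real.rpow_nonneg (hA s t) _) _ _)

lemma limsup_tiltedExponent_outputLaw_le [Nonempty S] (hp : p ∈ stdSimplex ℝ S)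
    (hπ : ∀ s, π s ∈ stdSimplex ℝ S) (f : S → X) (hθ : 0 ≤ θ)
    (h : IsPerronTriple (tiltedMatrix π θ) r u v) :
    limsup (fun n => (tiltedExponent (outputLaw p π f) θ n : EReal)) atTop ≤
      (((1 + θ) * Real.log r : ℝ) : EReal) := by
  have hπ₀ : ∀ s t, 0 ≤ π s t := fun s => (hπ s).1
  have hr := h.eigenvalue_pos
  obtain ⟨C, hC⟩ := exists_tiltSum_markovLaw_le hp.1 hπ₀ h
  refine limsup_one_div_nat_mul_le (d := (1 + θ) * (Real.log C - Real.log r)) fun m => ?_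
  have hpos := tiltSum_pos (isSource_outputLaw hp hπ f (m + 1)) θ
  have hle := (tiltSum_outputLaw_le hp.1 hπ₀ f hθ (m + 1)).trans (hC m)
  have hC₀ : 0 < C := pos_of_mul_pos_right (hpos.trans_le hle) (by positivity)
  calc (1 + θ) * Real.log (tiltSum (outputLaw p π f (m + 1)) θ)
      ≤ (1 + θ) * Real.log (r ^ m * C) := by gcongr
    _ = (m + 1) * ((1 + θ) * Real.log r) + (1 + θ) * (Real.log C - Real.log r) := by
        rw [Real.log_mul (by positivity) hC₀.ne', Real.log_pow]
        ring

theorem generalUpperBound_outputLaw_le_markovExponent (hp : p ∈ stdSimplex ℝ S)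
    (hπ : ∀ s, π s ∈ stdSimplex ℝ S) (hirr : π.IsIrreducible) (f : S → X) (hρ : 0 ≤ ρ) :
    generalUpperBound (outputLaw p π f) R ρ ≤ markovExponent π R ρ := by
  have : Nonempty S := (exists_pos_of_mem_stdSimplex hp).nonempty
  obtain ⟨Q, hQ, -⟩ := exists_mem_admissiblePairs_pos hirr
  obtain ⟨θ, hθ, Q₀, hQ₀, hsaddle⟩ := exists_pairTradeoff_le_pairValue ⟨Q, hQ⟩ R hρ
  obtain ⟨r, u, v, h⟩ := exists_isPerronTriple (isIrreducible_tiltedMatrix hirr θ)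
  have hθ₁ : 0 < 1 + θ := add_pos_of_pos_of_nonneg one_pos hθ.1
  calc generalUpperBound (outputLaw p π f) R ρ
      ≤ (((ρ - θ) * R : ℝ) : EReal) +
          limsup (fun n => (tiltedExponent (outputLaw p π f) θ n : EReal)) atTop := by
        rw [← iSup_upperTradeoff (isSource_outputLaw hp hπ f) hθ₁]
        exact iInf₂_le θ hθ
    _ ≤ (((ρ - θ) * R + (1 + θ) * Real.log r : ℝ) : EReal) := by
        rw [EReal.coe_add]
        gcongr
        exact limsup_tiltedExponent_outputLaw_le hp hπ f hθ.1 h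
    _ ≤ (pairValue π R ρ Q₀ : EReal) := by
        rw [← pairTradeoff_gibbsPair_tiltedMatrix hirr hθ₁.ne' h, EReal.coe_le_coe_iff]
        exact hsaddle _ (gibbsPair_tiltedMatrix_mem_admissiblePairs hirr hθ₁.ne' h)
    _ ≤ markovExponent π R ρ := by
        rw [markovExponent_eq_iSup_pairValue]
        exact le_iSup₂ (f := fun Q (_ : Q ∈ admissiblePairs π) => (pairValue π R ρ Q : EReal))
          Q₀ hQ₀

end Gibbs

/-! ### Additive functionals of irreducible chains -/

section Ergodic

open scoped Matrix

variable {S : Type*} [Fintype S] {η : Matrix S S ℝ} {p q : S → ℝ} {d : S → S → ℝ}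

lemma eq_of_mulVec_eq_self (hη : ∀ s, η s ∈ stdSimplex ℝ S) (hirr : η.IsIrreducible) {w : S → ℝ}
    (hw : η *ᵥ w = w) (s t : S) : w s = w t := by
  have : Nonempty S := ⟨s⟩
  obtain ⟨i, hi⟩ := Finite.exists_max w
  suffices hmax : ∀ j, w j = w i from (hmax s).trans (hmax t).symm
  refine forall_of_isIrreducible (P := fun j => w j = w i) hirr rfl fun j k hj hjk => ?_
  have hrow : ∑ k, η j k * w k = w j := congrFun hw j
  have hsum : ∑ k, η j k * (w i - w k) = 0 := by
    simp only [mul_sub, Finset.sum_sub_distrib, ← Finset.sum_mul, (hη j).2, hrow, hj, one_mul,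
      sub_self]
  have hzero := (Finset.sum_eq_zero_iff_of_nonneg fun k _ =>
    mul_nonneg ((hη j).1 k) (sub_nonneg.2 (hi k))).1 hsum k (Finset.mem_univ k)
  exact (sub_eq_zero.1 ((mul_eq_zero.1 hzero).resolve_left hjk.ne')).symm

/-- Poisson's equation: adding the projection `w ↦ (q ⬝ᵥ w) • 1` makes `1 - η` invertible, and does
not affect the solution because `q` annihilates the range of `1 - η`. -/
lemma exists_sub_mulVec_eq (h : IsIrreducibleStationary η q) {b : S → ℝ} (hb : q ⬝ᵥ b = 0) :
    ∃ w, w - η *ᵥ w = b := by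
  classical
  let T : (S → ℝ) →ₗ[ℝ] (S → ℝ) := (1 - η + Matrix.replicateRow S q).mulVecLin
  have hT : ∀ w, T w = w - η *ᵥ w + (q ⬝ᵥ w) • 1 := fun w => by
    ext s
    simp [T, Matrix.mulVec, Matrix.replicateRow]
  have hdot : ∀ w, q ⬝ᵥ T w = q ⬝ᵥ w := fun w => by
    simp [hT, dotProduct_add, dotProduct_sub, Matrix.dotProduct_mulVec, h.stationary,
      dotProduct_one, h.initial.2]
  have hker : ∀ w, q ⬝ᵥ w = 0 → T w = w - η *ᵥ w := fun w hw => by rw [hT, hw, zero_smul, add_zero]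
  have hinj : Function.Injective T := (injective_iff_map_eq_zero T).2 fun w hw => by
    have hqw : q ⬝ᵥ w = 0 := by rw [← hdot, hw, dotProduct_zero]
    have hconst := eq_of_mulVec_eq_self h.stochastic h.irreducible
      (sub_eq_zero.1 ((hker w hqw).symm.trans hw)).symm
    funext s
    calc w s = ∑ t, q t * w s := by rw [← Finset.sum_mul, h.initial.2, one_mul]
      _ = q ⬝ᵥ w := Finset.sum_congr rfl fun t _ => by rw [hconst s t]
      _ = 0 := hqw
  obtain ⟨w, rfl⟩ := LinearMap.injective_iff_surjective.1 hinj b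
  exact ⟨w, (hker w (by rw [← hdot, hb])).symm⟩

/-- The mean of `g` over a transition of the stationary chain with transition matrix `η` and
stationary distribution `q`. -/
def stationaryMean (η : Matrix S S ℝ) (q : S → ℝ) (g : S → S → ℝ) : ℝ :=
  ∑ s, q s * ∑ t, η s t * g s t

omit [Fintype S] in
lemma pathSum_add_coboundary (g : S → S → ℝ) (w : S → ℝ) (c : ℝ) {m : ℕ} (x : Fin (m + 1) → S) :
    pathSum (fun s t => g s t + w t - w s - c) x =
      pathSum g x + w (x (Fin.last m)) - w (x 0) - m * c := by
  have htelescope := Fin.sum_univ_succ fun i => w (x i)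
  rw [Fin.sum_univ_castSucc] at htelescope
  simp only [pathSum, Finset.sum_sub_distrib, Finset.sum_add_distrib, Finset.sum_const,
    Finset.card_univ, Fintype.card_fin, nsmul_eq_mul]
  linarith

lemma exists_martingale_approximation (h : IsIrreducibleStationary η q) (g : S → S → ℝ) :
    ∃ (d : S → S → ℝ) (E : ℝ), (∀ s, ∑ t, η s t * d s t = 0) ∧
      ∀ (m : ℕ) (x : Fin (m + 1) → S),
        |pathSum g x - (m + 1) * stationaryMean η q g - pathSum d x| ≤ E := by
  set c := stationaryMean η q g with hc
  obtain ⟨w, hw⟩ := exists_sub_mulVec_eq h (b := fun s => ∑ t, η s t * g s t - c) <| by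
    simp only [dotProduct, mul_sub, Finset.sum_sub_distrib, ← Finset.sum_mul, h.initial.2, hc,
      stationaryMean, one_mul, sub_self]
  have hw' : ∀ s, w s - ∑ t, η s t * w t = ∑ t, η s t * g s t - c := congrFun hw
  obtain ⟨W, hW⟩ := (Set.finite_range fun s => |w s|).bddAbove
  have hW' : ∀ s, |w s| ≤ W := fun s => hW (Set.mem_range_self s)
  refine ⟨fun s t => g s t + w t - w s - c, 2 * W + |c|, fun s => ?_, fun m x => ?_⟩
  · simp only [mul_sub, mul_add, Finset.sum_sub_distrib, Finset.sum_add_distrib,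
      ← Finset.sum_mul, (h.stochastic s).2]
    linarith [hw' s]
  · calc |pathSum g x - (m + 1) * c - pathSum (fun s t => g s t + w t - w s - c) x|
        = |w (x 0) - w (x (Fin.last m)) - c| := by
          rw [pathSum_add_coboundary]
          ring_nf
      _ ≤ |w (x 0)| + |w (x (Fin.last m))| + |c| :=
          (abs_sub _ _).trans (by gcongr; exact abs_sub _ _)
      _ ≤ 2 * W + |c| := by linarith [hW' (x 0), hW' (x (Fin.last m))]

lemma sum_markovLaw_mul_pathSum_eq_zero (p : S → ℝ) (hη : ∀ s, η s ∈ stdSimplex ℝ S)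
    (hd : ∀ s, ∑ t, η s t * d s t = 0) (m : ℕ) :
    ∑ x, markovLaw p η (m + 1) x * pathSum d x = 0 := by
  induction m with
  | zero => simp [pathSum]
  | succ m ih =>
    simp only [pathSum_init]
    rw [sum_markovLaw_mul_init p η m fun y t => pathSum d y + d (y (Fin.last m)) t]
    simpa only [mul_add, Finset.sum_add_distrib, ← Finset.sum_mul, (hη _).2, hd, one_mul, mul_zero,
      Finset.sum_const_zero, add_zero] using ih

lemma sum_mul_add_sq_le {μ D : S → ℝ} (hμ : μ ∈ stdSimplex ℝ S) (hD : ∑ t, μ t * D t = 0) {B : ℝ}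
    (hB : ∑ t, μ t * D t ^ 2 ≤ B) (a : ℝ) : ∑ t, μ t * (a + D t) ^ 2 ≤ a ^ 2 + B := by
  have hexpand : ∀ t, μ t * (a + D t) ^ 2 =
      μ t * a ^ 2 + 2 * a * (μ t * D t) + μ t * D t ^ 2 := fun t => by ring
  simp only [hexpand, Finset.sum_add_distrib, ← Finset.sum_mul, ← Finset.mul_sum, hμ.2, hD]
  linarith

lemma sum_markovLaw_mul_pathSum_sq_le (hp : p ∈ stdSimplex ℝ S) (hη : ∀ s, η s ∈ stdSimplex ℝ S)
    (hd : ∀ s, ∑ t, η s t * d s t = 0) {B : ℝ} (hB : ∀ s, ∑ t, η s t * d s t ^ 2 ≤ B) (m : ℕ) :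
    ∑ x, markovLaw p η (m + 1) x * pathSum d x ^ 2 ≤ m * B := by
  induction m with
  | zero => simp [pathSum]
  | succ m ih =>
    have hsrc := isSource_markovLaw hp hη (m + 1)
    simp only [pathSum_init]
    calc _ = ∑ y, markovLaw p η (m + 1) y * ∑ t, η (y (Fin.last m)) t *
            (pathSum d y + d (y (Fin.last m)) t) ^ 2 :=
          sum_markovLaw_mul_init p η m fun y t => (pathSum d y + d (y (Fin.last m)) t) ^ 2
      _ ≤ ∑ y, markovLaw p η (m + 1) y * (pathSum d y ^ 2 + B) :=
          Finset.sum_le_sum fun y _ => mul_le_mul_of_nonneg_left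
            (sum_mul_add_sq_le (hη _) (hd _) (hB _) _) (hsrc.1 y)
      _ = ∑ y, markovLaw p η (m + 1) y * pathSum d y ^ 2 + B := by
          simp only [mul_add, Finset.sum_add_distrib, ← Finset.sum_mul, hsrc.2, one_mul]
      _ ≤ m * B + B := by gcongr
      _ = (m + 1 : ℕ) * B := by push_cast; ring

theorem exists_abs_sum_markovLaw_mul_pathSum_sub_le (hp : p ∈ stdSimplex ℝ S)
    (h : IsIrreducibleStationary η q) (g : S → S → ℝ) :
    ∃ E : ℝ, ∀ m : ℕ, |∑ x, markovLaw p η (m + 1) x * pathSum g x -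
      (m + 1) * stationaryMean η q g| ≤ E := by
  obtain ⟨d, E, hd, hE⟩ := exists_martingale_approximation h g
  refine ⟨E, fun m => ?_⟩
  have hsrc := isSource_markovLaw hp h.stochastic (m + 1)
  calc |∑ x, markovLaw p η (m + 1) x * pathSum g x - (m + 1) * stationaryMean η q g|
      = |∑ x, markovLaw p η (m + 1) x *
          (pathSum g x - (m + 1) * stationaryMean η q g - pathSum d x)| := by
        simp only [mul_sub, Finset.sum_sub_distrib, ← Finset.sum_mul, hsrc.2, one_mul, sub_zero,
          sum_markovLaw_mul_pathSum_eq_zero p h.stochastic hd m]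
    _ ≤ ∑ x, markovLaw p η (m + 1) x *
          |pathSum g x - (m + 1) * stationaryMean η q g - pathSum d x| := by
        refine (Finset.abs_sum_le_sum_abs _ _).trans (Finset.sum_le_sum fun x _ => ?_)
        rw [abs_mul, abs_of_nonneg (hsrc.1 x)]
    _ ≤ ∑ x, markovLaw p η (m + 1) x * E :=
        Finset.sum_le_sum fun x _ => mul_le_mul_of_nonneg_left (hE m x) (hsrc.1 x)
    _ = E := by rw [← Finset.sum_mul, hsrc.2, one_mul]

theorem exists_sum_markovLaw_mul_pathSum_sub_sq_le (hp : p ∈ stdSimplex ℝ S)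
    (h : IsIrreducibleStationary η q) (g : S → S → ℝ) :
    ∃ K : ℝ, ∀ m : ℕ, ∑ x, markovLaw p η (m + 1) x *
      (pathSum g x - (m + 1) * stationaryMean η q g) ^ 2 ≤ (m + 1) * K := by
  obtain ⟨d, E, hd, hE⟩ := exists_martingale_approximation h g
  obtain ⟨B, hB⟩ := (Set.finite_range fun s => ∑ t, η s t * d s t ^ 2).bddAbove
  have hvar : ∀ s, ∑ t, η s t * d s t ^ 2 ≤ |B| := fun s =>
    (hB (Set.mem_range_self s)).trans (le_abs_self B)
  refine ⟨2 * |B| + 2 * E ^ 2, fun m => ?_⟩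
  have hsrc := isSource_markovLaw hp h.stochastic (m + 1)
  have hsq : ∀ x : Fin (m + 1) → S, (pathSum g x - (m + 1) * stationaryMean η q g) ^ 2 ≤
      2 * pathSum d x ^ 2 + 2 * E ^ 2 := fun x => by
    have hle := sq_le_sq' (abs_le.1 (hE m x)).1 (abs_le.1 (hE m x)).2
    nlinarith [sq_nonneg (pathSum g x - (m + 1) * stationaryMean η q g - 2 * pathSum d x)]
  calc _ ≤ ∑ x, markovLaw p η (m + 1) x * (2 * pathSum d x ^ 2 + 2 * E ^ 2) :=
        Finset.sum_le_sum fun x _ => mul_le_mul_of_nonneg_left (hsq x) (hsrc.1 x)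
    _ = 2 * ∑ x, markovLaw p η (m + 1) x * pathSum d x ^ 2 + 2 * E ^ 2 := by
        simp only [mul_add, Finset.sum_add_distrib, ← Finset.sum_mul, hsrc.2, one_mul,
          mul_left_comm _ (2 : ℝ), ← Finset.mul_sum]
    _ ≤ 2 * (m * |B|) + 2 * E ^ 2 := by
        gcongr
        exact sum_markovLaw_mul_pathSum_sq_le hp h.stochastic hd hvar m
    _ ≤ (m + 1) * (2 * |B| + 2 * E ^ 2) := by
        have : 0 ≤ (m : ℝ) * E ^ 2 := by positivity
        linarith [abs_nonneg B]

end Ergodic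

/-! ### Unifilar outputs of a chain with a fixed initial state -/

section Output

variable {S X : Type*} {p q : S → ℝ} {A η π : Matrix S S ℝ} {f : S → X} {s₀ : S} {R ρ : ℝ}

lemma log_markovLaw {m : ℕ} {x : Fin (m + 1) → S} (h : markovLaw p A (m + 1) x ≠ 0) :
    Real.log (markovLaw p A (m + 1) x) =
      Real.log (p (x 0)) + pathSum (fun s t => Real.log (A s t)) x := by
  obtain ⟨hinit, hstep⟩ := mul_ne_zero_iff.1 h
  rw [markovLaw, Real.log_mul hinit hstep,
    Real.log_prod fun i _ => Finset.prod_ne_zero_iff.1 hstep i (Finset.mem_univ i)]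
  rfl

lemma apply_pos_of_markovLaw_ne_zero (hA : ∀ s t, 0 ≤ A s t) {m : ℕ} {x : Fin (m + 1) → S}
    (h : markovLaw p A (m + 1) x ≠ 0) (i : Fin m) : 0 < A (x i.castSucc) (x i.succ) :=
  (hA _ _).lt_of_ne' (Finset.prod_ne_zero_iff.1 (mul_ne_zero_iff.1 h).2 i (Finset.mem_univ i))

lemma IsUnifilar.of_pos_imp_pos (hf : IsUnifilar π f) (h : ∀ s t, 0 < η s t → 0 < π s t) :
    IsUnifilar η f :=
  fun s t u ht hu => hf s t u (h s t ht) (h s u hu)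

section Single

variable [DecidableEq S]

lemma apply_zero_of_markovLaw_single_ne_zero {m : ℕ} {x : Fin (m + 1) → S}
    (h : markovLaw (Pi.single s₀ 1) A (m + 1) x ≠ 0) : x 0 = s₀ := by
  by_contra hne
  exact (mul_ne_zero_iff.1 h).1 (Pi.single_eq_of_ne hne 1)

lemma log_markovLaw_single {m : ℕ} {x : Fin (m + 1) → S}
    (h : markovLaw (Pi.single s₀ 1) A (m + 1) x ≠ 0) :
    Real.log (markovLaw (Pi.single s₀ 1) A (m + 1) x) =
      pathSum (fun s t => Real.log (A s t)) x := by
  rw [log_markovLaw h, apply_zero_of_markovLaw_single_ne_zero h, Pi.single_eq_same, Real.log_one,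
    zero_add]

lemma markovLaw_pos_of_single_ne_zero (hη : ∀ s t, 0 ≤ η s t)
    (hdom : ∀ s t, 0 < η s t → 0 < π s t) (hs₀ : 0 < p s₀) {n : ℕ} {x : Fin n → S}
    (h : markovLaw (Pi.single s₀ 1) η n x ≠ 0) : 0 < markovLaw p π n x := by
  cases n with
  | zero => exact zero_lt_one
  | succ m =>
    refine mul_pos ?_ (Finset.prod_pos fun i _ =>
      hdom _ _ (apply_pos_of_markovLaw_ne_zero hη h i))
    rwa [apply_zero_of_markovLaw_single_ne_zero h]

lemma eq_of_comp_eq_of_markovLaw_single_ne_zero (hη : ∀ s t, 0 ≤ η s t) (hf : IsUnifilar η f)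
    {n : ℕ} {x y : Fin n → S} (hx : markovLaw (Pi.single s₀ 1) η n x ≠ 0)
    (hy : markovLaw (Pi.single s₀ 1) η n y ≠ 0) (h : f ∘ x = f ∘ y) : x = y := by
  cases n with
  | zero => exact Subsingleton.elim _ _
  | succ m =>
    funext i
    induction i using Fin.induction with
    | zero =>
      rw [apply_zero_of_markovLaw_single_ne_zero hx, apply_zero_of_markovLaw_single_ne_zero hy]
    | succ i ih =>
      have hstep := apply_pos_of_markovLaw_ne_zero hη hy i
      rw [← ih] at hstep
      exact hf _ _ _ (apply_pos_of_markovLaw_ne_zero hη hx i) hstep (congrFun h i.succ)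

end Single

variable [Fintype S]

lemma markovLaw_le_outputLaw (hp : ∀ s, 0 ≤ p s) (hA : ∀ s t, 0 ≤ A s t) (f : S → X) {n : ℕ}
    (x : Fin n → S) : markovLaw p A n x ≤ outputLaw p A f n (f ∘ x) := by
  classical
  exact Finset.single_le_sum (fun s _ => markovLaw_nonneg hp hA n s)
    (Finset.mem_filter.2 ⟨Finset.mem_univ _, rfl⟩)

section Single

variable [DecidableEq S]

lemma outputLaw_single_comp (hη : ∀ s t, 0 ≤ η s t) (hf : IsUnifilar η f) {n : ℕ}
    {x : Fin n → S} (hx : markovLaw (Pi.single s₀ 1) η n x ≠ 0) :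
    outputLaw (Pi.single s₀ 1) η f n (f ∘ x) = markovLaw (Pi.single s₀ 1) η n x := by
  classical
  refine Finset.sum_eq_single_of_mem x (Finset.mem_filter.2 ⟨Finset.mem_univ _, rfl⟩) ?_
  intro y hy hne
  by_contra hy₀
  exact hne (eq_of_comp_eq_of_markovLaw_single_ne_zero hη hf hy₀ hx (Finset.mem_filter.1 hy).2)

lemma absCont_outputLaw_single (hp : ∀ s, 0 ≤ p s) (hs₀ : 0 < p s₀) (hη : ∀ s t, 0 ≤ η s t)
    (hπ : ∀ s t, 0 ≤ π s t) (hdom : ∀ s t, 0 < η s t → 0 < π s t) (f : S → X) (n : ℕ) :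
    AbsCont (outputLaw (Pi.single s₀ 1) η f n) (outputLaw p π f n) := by
  classical
  intro x hx
  refine Finset.sum_eq_zero fun s hs => ?_
  obtain rfl := (Finset.mem_filter.1 hs).2
  by_contra hne
  exact ((markovLaw_pos_of_single_ne_zero hη hdom hs₀ hne).trans_le
    (markovLaw_le_outputLaw hp hπ f s)).ne' hx

lemma log_outputLaw_single_sub_log_le (hf : IsUnifilar η f) (hη : ∀ s t, 0 ≤ η s t)
    (hp : ∀ s, 0 ≤ p s) (hs₀ : 0 < p s₀) (hπ : ∀ s t, 0 ≤ π s t)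
    (hdom : ∀ s t, 0 < η s t → 0 < π s t) {m : ℕ} {s : Fin (m + 1) → S}
    (hs : markovLaw (Pi.single s₀ 1) η (m + 1) s ≠ 0) :
    Real.log (outputLaw (Pi.single s₀ 1) η f (m + 1) (f ∘ s)) -
        Real.log (outputLaw p π f (m + 1) (f ∘ s)) ≤
      pathSum (fun s t => Real.log (η s t) - Real.log (π s t)) s - Real.log (p s₀) := by
  have hpos := markovLaw_pos_of_single_ne_zero hη hdom hs₀ hs
  have hle := Real.log_le_log hpos (markovLaw_le_outputLaw hp hπ f s)
  rw [log_markovLaw hpos.ne', apply_zero_of_markovLaw_single_ne_zero hs] at hle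
  rw [outputLaw_single_comp hη hf hs, log_markovLaw_single hs]
  simp only [pathSum, Finset.sum_sub_distrib] at hle ⊢
  linarith

variable [Fintype X]

/-- Unifilarity makes the output determine the path, so both have the same surprisal. -/
lemma sum_outputLaw_single_mul_log (hη : ∀ s t, 0 ≤ η s t) (hf : IsUnifilar η f) (s₀ : S) (m : ℕ)
    (F : ℝ → ℝ) :
    ∑ x, outputLaw (Pi.single s₀ 1) η f (m + 1) x *
        F (Real.log (1 / outputLaw (Pi.single s₀ 1) η f (m + 1) x)) =
      ∑ s, markovLaw (Pi.single s₀ 1) η (m + 1) s *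
        F (pathSum (fun s t => -Real.log (η s t)) s) := by
  rw [sum_outputLaw_mul (Pi.single s₀ 1) η f fun x =>
    F (Real.log (1 / outputLaw (Pi.single s₀ 1) η f (m + 1) x))]
  refine Finset.sum_congr rfl fun s _ => ?_
  rcases eq_or_ne (markovLaw (Pi.single s₀ 1) η (m + 1) s) 0 with h₀ | h₀
  · rw [h₀, zero_mul, zero_mul]
  · rw [outputLaw_single_comp hη hf h₀, one_div, Real.log_inv, log_markovLaw_single h₀]
    simp only [pathSum, Finset.sum_neg_distrib]

end Single

lemma sum_filter_le_second_moment {α : Type*} [Fintype α] {μ Z : α → ℝ} (hμ : ∀ x, 0 ≤ μ x)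
    (P : α → Prop) [DecidablePred P] {a : ℝ} (ha : 0 < a) (h : ∀ x, P x → a ≤ |Z x|) :
    ∑ x with P x, μ x ≤ 1 / a ^ 2 * ∑ x, μ x * Z x ^ 2 := by
  rw [one_div_mul_eq_div, le_div_iff₀ (by positivity), Finset.sum_mul]
  calc ∑ x with P x, μ x * a ^ 2 ≤ ∑ x with P x, μ x * Z x ^ 2 := by
        refine Finset.sum_le_sum fun x hx => mul_le_mul_of_nonneg_left ?_ (hμ x)
        rw [← sq_abs (Z x)]
        exact pow_le_pow_left₀ ha.le (h x (Finset.mem_filter.1 hx).2) 2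
    _ ≤ ∑ x, μ x * Z x ^ 2 := Finset.sum_le_sum_of_subset_of_nonneg (Finset.subset_univ _)
        fun x _ _ => mul_nonneg (hμ x) (sq_nonneg _)

section SpectralRates

variable [Fintype X] {Q : MessageLaw X} {c : ℝ}

lemma supEntropyRate_le_of_tendsto (hQ : IsSource Q)
    (h : Tendsto (fun n : ℕ => ∑ x, Q n x * (1 / (n : ℝ) * Real.log (1 / Q n x) - c) ^ 2) atTop
      (𝓝 0)) : supEntropyRate Q ≤ c := by
  refine le_of_forall_gt fun t ht => ?_
  obtain ⟨r, hcr, hrt⟩ := EReal.lt_iff_exists_real_btwn.1 ht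
  have hpos : 0 < r - c := sub_pos.2 (EReal.coe_lt_coe_iff.1 hcr)
  refine (iInf₂_le r ?_).trans_lt hrt
  refine squeeze_zero (fun n => Finset.sum_nonneg fun x _ => (hQ n).1 x)
    (fun n => sum_filter_le_second_moment (hQ n).1 _ hpos fun x hx => ?_)
    (by simpa only [mul_zero] using h.const_mul (1 / (r - c) ^ 2))
  exact (sub_le_sub_right hx.le c).trans (le_abs_self _)

lemma le_infEntropyRate_of_tendsto (hQ : IsSource Q)
    (h : Tendsto (fun n : ℕ => ∑ x, Q n x * (1 / (n : ℝ) * Real.log (1 / Q n x) - c) ^ 2) atTop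
      (𝓝 0)) : c ≤ infEntropyRate Q := by
  refine le_of_forall_lt fun t ht => ?_
  obtain ⟨r, htr, hrc⟩ := EReal.lt_iff_exists_real_btwn.1 ht
  have hpos : 0 < c - r := sub_pos.2 (EReal.coe_lt_coe_iff.1 hrc)
  refine htr.trans_le (le_iSup₂_of_le r ?_ le_rfl)
  refine squeeze_zero (fun n => Finset.sum_nonneg fun x _ => (hQ n).1 x)
    (fun n => sum_filter_le_second_moment (hQ n).1 _ hpos fun x hx => ?_)
    (by simpa only [mul_zero] using h.const_mul (1 / (c - r) ^ 2))
  exact (sub_le_sub_left hx.le c).trans (abs_sub_comm _ c ▸ le_abs_self _)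

end SpectralRates

/-- The entropy rate of the stationary chain with transition matrix `η` and stationary
distribution `q`. -/
noncomputable def entropyRate (η : Matrix S S ℝ) (q : S → ℝ) : ℝ :=
  stationaryMean η q fun s t => -Real.log (η s t)

/-- The divergence rate of the stationary chain with transition matrix `η` and stationary
distribution `q` from a chain with transition matrix `π`; it is the intended quantity only if `η` is
dominated by `π`. -/
noncomputable def divergenceRate (η π : Matrix S S ℝ) (q : S → ℝ) : ℝ :=
  stationaryMean η q fun s t => Real.log (η s t) - Real.log (π s t)

variable [DecidableEq S] [Fintype X]

lemma tendsto_second_moment_outputLaw_single (h : IsIrreducibleStationary η q)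
    (hf : IsUnifilar η f) (s₀ : S) :
    Tendsto (fun n : ℕ => ∑ x, outputLaw (Pi.single s₀ 1) η f n x *
      (1 / (n : ℝ) * Real.log (1 / outputLaw (Pi.single s₀ 1) η f n x) - entropyRate η q) ^ 2)
      atTop (𝓝 0) := by
  have hsingle := single_mem_stdSimplex ℝ s₀
  obtain ⟨K, hK⟩ := exists_sum_markovLaw_mul_pathSum_sub_sq_le hsingle h
    fun s t => -Real.log (η s t)
  have hsrc := isSource_outputLaw hsingle h.stochastic f
  refine squeeze_zero' (Eventually.of_forall fun n =>
    Finset.sum_nonneg fun x _ => mul_nonneg ((hsrc n).1 x) (sq_nonneg _)) ?_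
    (tendsto_one_div_nat_mul K)
  filter_upwards [eventually_gt_atTop 0] with n hn
  obtain ⟨m, rfl⟩ := Nat.exists_eq_succ_of_ne_zero hn.ne'
  rw [Nat.succ_eq_add_one, Nat.cast_add_one,
    sum_outputLaw_single_mul_log h.irreducible.nonneg hf s₀ m
      fun z => (1 / ((m : ℝ) + 1) * z - entropyRate η q) ^ 2]
  calc _ = 1 / ((m : ℝ) + 1) ^ 2 * ∑ s, markovLaw (Pi.single s₀ 1) η (m + 1) s *
        (pathSum (fun s t => -Real.log (η s t)) s - (m + 1) * entropyRate η q) ^ 2 := by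
        rw [Finset.mul_sum]
        refine Finset.sum_congr rfl fun s _ => ?_
        field_simp
    _ ≤ 1 / ((m : ℝ) + 1) ^ 2 * ((m + 1) * K) := by
        gcongr
        exact hK m
    _ = 1 / ((m : ℝ) + 1) * K := by field_simp

lemma exists_le_entropy_outputLaw_single (h : IsIrreducibleStationary η q) (hf : IsUnifilar η f)
    (s₀ : S) : ∃ E : ℝ, ∀ m : ℕ,
      (m + 1) * entropyRate η q - E ≤ entropy (outputLaw (Pi.single s₀ 1) η f (m + 1)) := by
  obtain ⟨E, hE⟩ := exists_abs_sum_markovLaw_mul_pathSum_sub_le (single_mem_stdSimplex ℝ s₀) h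
    fun s t => -Real.log (η s t)
  refine ⟨E, fun m => ?_⟩
  have hentropy : entropy (outputLaw (Pi.single s₀ 1) η f (m + 1)) =
      ∑ s, markovLaw (Pi.single s₀ 1) η (m + 1) s * pathSum (fun s t => -Real.log (η s t)) s := by
    rw [← sum_outputLaw_single_mul_log h.irreducible.nonneg hf s₀ m fun z => z,
      entropy_eq_neg_sum, ← Finset.sum_neg_distrib]
    simp only [one_div, Real.log_inv, mul_neg]
  rw [hentropy, entropyRate]
  linarith [(abs_le.1 (hE m)).1]

lemma exists_klSum_outputLaw_single_le (h : IsIrreducibleStationary η q) (hf : IsUnifilar η f)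
    (hp : ∀ s, 0 ≤ p s) (hs₀ : 0 < p s₀) (hπ : ∀ s t, 0 ≤ π s t)
    (hdom : ∀ s t, 0 < η s t → 0 < π s t) :
    ∃ K : ℝ, ∀ m : ℕ, klSum (outputLaw (Pi.single s₀ 1) η f (m + 1)) (outputLaw p π f (m + 1)) ≤
      (m + 1) * divergenceRate η π q + K := by
  obtain ⟨E, hE⟩ := exists_abs_sum_markovLaw_mul_pathSum_sub_le (single_mem_stdSimplex ℝ s₀) h
    fun s t => Real.log (η s t) - Real.log (π s t)
  refine ⟨E - Real.log (p s₀), fun m => ?_⟩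
  have hsrc := isSource_markovLaw (single_mem_stdSimplex ℝ s₀) h.stochastic (m + 1)
  calc _ = ∑ s, markovLaw (Pi.single s₀ 1) η (m + 1) s *
        (Real.log (outputLaw (Pi.single s₀ 1) η f (m + 1) (f ∘ s)) -
          Real.log (outputLaw p π f (m + 1) (f ∘ s))) :=
        sum_outputLaw_mul (Pi.single s₀ 1) η f fun x =>
          Real.log (outputLaw (Pi.single s₀ 1) η f (m + 1) x) -
            Real.log (outputLaw p π f (m + 1) x)
    _ ≤ ∑ s, markovLaw (Pi.single s₀ 1) η (m + 1) s *
        (pathSum (fun s t => Real.log (η s t) - Real.log (π s t)) s - Real.log (p s₀)) := by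
        refine Finset.sum_le_sum fun s _ => ?_
        rcases eq_or_ne (markovLaw (Pi.single s₀ 1) η (m + 1) s) 0 with hs | hs
        · rw [hs, zero_mul, zero_mul]
        · exact mul_le_mul_of_nonneg_left (log_outputLaw_single_sub_log_le hf
            h.irreducible.nonneg hp hs₀ hπ hdom hs) (hsrc.1 s)
    _ = ∑ s, markovLaw (Pi.single s₀ 1) η (m + 1) s *
          pathSum (fun s t => Real.log (η s t) - Real.log (π s t)) s - Real.log (p s₀) := by
        simp only [mul_sub, Finset.sum_sub_distrib, ← Finset.sum_mul, hsrc.2, one_mul]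
    _ ≤ (m + 1) * divergenceRate η π q + (E - Real.log (p s₀)) := by
        rw [divergenceRate]
        linarith [(abs_le.1 (hE m)).2]

lemma upperDivergence_outputLaw_single_le (h : IsIrreducibleStationary η q) (hf : IsUnifilar η f)
    (hp : ∀ s, 0 ≤ p s) (hs₀ : 0 < p s₀) (hπ : ∀ s t, 0 ≤ π s t)
    (hdom : ∀ s t, 0 < η s t → 0 < π s t) :
    upperDivergence (outputLaw (Pi.single s₀ 1) η f) (outputLaw p π f) ≤ divergenceRate η π q := by
  obtain ⟨K, hK⟩ := exists_klSum_outputLaw_single_le h hf hp hs₀ hπ hdom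
  have hac := absCont_outputLaw_single hp hs₀ h.irreducible.nonneg hπ hdom f
  simp only [upperDivergence, divergence_of_absCont (hac _), ← EReal.coe_mul]
  exact limsup_one_div_nat_mul_le hK

lemma le_lowerTradeoff_outputLaw_single (h : IsIrreducibleStationary η q) (hf : IsUnifilar η f)
    (hp : ∀ s, 0 ≤ p s) (hs₀ : 0 < p s₀) (hπ : ∀ s t, 0 ≤ π s t)
    (hdom : ∀ s t, 0 < η s t → 0 < π s t) (hρ : 0 ≤ ρ) :
    ((ρ * entropyRate η q - divergenceRate η π q : ℝ) : EReal) ≤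
      lowerTradeoff (outputLaw (Pi.single s₀ 1) η f) (outputLaw p π f) ρ := by
  obtain ⟨K, hK⟩ := exists_klSum_outputLaw_single_le h hf hp hs₀ hπ hdom
  obtain ⟨E, hE⟩ := exists_le_entropy_outputLaw_single h hf s₀
  have hac := absCont_outputLaw_single hp hs₀ h.irreducible.nonneg hπ hdom f
  simp only [lowerTradeoff, tradeoff_of_absCont (hac _)]
  refine le_liminf_one_div_nat_mul (d := -(ρ * E + K)) fun m => ?_
  linarith [mul_le_mul_of_nonneg_left (hE m) hρ, hK m]

omit [DecidableEq S] in
/-- The output of the chain `η` started at a single state competes in the first or in the second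
term of the lower bound, according to whether its entropy rate exceeds `R`. -/
theorem rate_le_generalLowerBound_outputLaw (h : IsIrreducibleStationary η q)
    (hf : IsUnifilar η f) (hp : p ∈ stdSimplex ℝ S) (hπ : ∀ s t, 0 ≤ π s t)
    (hdom : ∀ s t, 0 < η s t → 0 < π s t) (hρ : 0 ≤ ρ) :
    ((ρ * min (entropyRate η q) R - divergenceRate η π q : ℝ) : EReal) ≤
      generalLowerBound (outputLaw p π f) R ρ := by
  classical
  obtain ⟨s₀, hs₀⟩ := exists_pos_of_mem_stdSimplex hp
  have hsrc := isSource_outputLaw (single_mem_stdSimplex ℝ s₀) h.stochastic f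
  have hmoment := tendsto_second_moment_outputLaw_single h hf s₀
  rcases le_or_gt (entropyRate η q) R with hR | hR
  · rw [min_eq_left hR]
    refine le_max_of_le_right (le_iSup₂_of_le (outputLaw (Pi.single s₀ 1) η f) hsrc
      (le_iSup_of_le ?_ (le_lowerTradeoff_outputLaw_single h hf hp.1 hs₀ hπ hdom hρ)))
    exact (supEntropyRate_le_of_tendsto hsrc hmoment).trans (EReal.coe_le_coe_iff.2 hR)
  · rw [min_eq_right hR.le, EReal.coe_sub]
    refine le_max_of_le_left (EReal.sub_le_sub le_rfl ?_)
    refine iInf₂_le_of_le (outputLaw (Pi.single s₀ 1) η f) hsrc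
      (iInf_le_of_le ?_ (upperDivergence_outputLaw_single_le h hf hp.1 hs₀ hπ hdom))
    exact (EReal.coe_lt_coe_iff.2 hR).trans_le (le_infEntropyRate_of_tendsto hsrc hmoment)

end Output

/-! ### The four equalities -/

section Conclusion

variable {S X : Type*} [Fintype S] {π : Matrix S S ℝ} {p : S → ℝ} {f : S → X} {R ρ : ℝ}
  {Q : S × S → ℝ}

lemma condDist_pos_iff (hQ : 0 ≤ Q) {s t : S} (hs : marginal Q s ≠ 0) :
    0 < condDist Q s t ↔ 0 < Q (s, t) := by
  rw [← marginal_mul_condDist hQ s t, mul_pos_iff_of_pos_left ((marginal_nonneg hQ s).lt_of_ne' hs)]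

lemma marginal_ne_zero_of_pos (hQ : 0 ≤ Q) {s t : S} (h : 0 < Q (s, t)) : marginal Q s ≠ 0 :=
  fun h₀ => h.ne' (eq_zero_of_marginal_eq_zero hQ h₀ t)

lemma isIrreducibleStationary_condDist (hπ : π.IsIrreducible) (hQ : Q ∈ stationaryPairs S)
    (hpos : ∀ s t, 0 < π s t → 0 < Q (s, t)) :
    IsIrreducibleStationary (condDist Q) (marginal Q) where
  stochastic := condDist_mem_stdSimplex hQ.1.1
  irreducible := isIrreducible_of_pos_imp_pos hπ (fun s => (condDist_mem_stdSimplex hQ.1.1 s).1)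
    fun s t h => (condDist_pos_iff hQ.1.1 (marginal_ne_zero_of_pos hQ.1.1 (hpos s t h))).2
      (hpos s t h)
  initial := marginal_mem_stdSimplex hQ.1
  stationary := by
    funext t
    simp only [Matrix.vecMul, dotProduct, marginal_mul_condDist hQ.1.1]
    exact hQ.2 t

lemma entropyRate_condDist (hQ : 0 ≤ Q) :
    entropyRate (condDist Q) (marginal Q) = condEntropy Q := by
  refine (sum_marginal_mul_sum_condDist_mul hQ _).trans ?_
  simp only [condEntropy_eq_neg_sum hQ, mul_neg, Finset.sum_neg_distrib]

lemma divergenceRate_condDist (π : Matrix S S ℝ) (hQ : 0 ≤ Q) :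
    divergenceRate (condDist Q) π (marginal Q) = -pairTradeoff π 0 Q := by
  refine (sum_marginal_mul_sum_condDist_mul hQ _).trans ?_
  simp only [pairTradeoff, condEntropy_eq_neg_sum hQ, mul_sub, Finset.sum_sub_distrib]
  ring

lemma outputLaw_id (p : S → ℝ) (π : Matrix S S ℝ) : outputLaw p π id = markovLaw p π := by
  classical
  funext n x
  simp only [outputLaw, Function.id_comp]
  rw [Finset.sum_filter, Finset.sum_ite_eq' Finset.univ x, if_pos (Finset.mem_univ x)]

variable [Fintype X]

lemma pairValue_le_generalLowerBound_of_pos (hp : p ∈ stdSimplex ℝ S) (hπ : π.IsIrreducible)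
    (hf : IsUnifilar π f) (hρ : 0 ≤ ρ) (hQ : Q ∈ admissiblePairs π)
    (hpos : ∀ s t, 0 < π s t → 0 < Q (s, t)) :
    (pairValue π R ρ Q : EReal) ≤ generalLowerBound (outputLaw p π f) R ρ := by
  have hQ₀ := nonneg_of_mem_admissiblePairs hQ
  have hdom : ∀ s t, 0 < condDist Q s t → 0 < π s t := fun s t h => by
    obtain ⟨u, hu⟩ := exists_pos_apply hπ s
    have hs := marginal_ne_zero_of_pos hQ₀ (hpos s u hu)
    exact (hπ.nonneg s t).lt_of_ne' fun h₀ =>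
      ((condDist_pos_iff hQ₀ hs).1 h).ne' (hQ.2 s t h₀)
  have hrate := rate_le_generalLowerBound_outputLaw (R := R)
    (isIrreducibleStationary_condDist hπ hQ.1 hpos) (hf.of_pos_imp_pos hdom) hp hπ.nonneg hdom hρ
  rwa [entropyRate_condDist hQ₀, divergenceRate_condDist π hQ₀, sub_neg_eq_add] at hrate

theorem markovExponent_le_generalLowerBound_outputLaw (hp : p ∈ stdSimplex ℝ S)
    (hπ : π.IsIrreducible) (hf : IsUnifilar π f) (hρ : 0 ≤ ρ) :
    markovExponent π R ρ ≤ generalLowerBound (outputLaw p π f) R ρ := by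
  have : Nonempty S := (exists_pos_of_mem_stdSimplex hp).nonempty
  obtain ⟨Q₀, hQ₀, hpos⟩ := exists_mem_admissiblePairs_pos hπ
  rw [markovExponent_eq_iSup_pairValue]
  refine iSup₂_le fun Q hQ => ?_
  let mix : ℝ → S × S → ℝ := fun ε => (1 - ε) • Q + ε • Q₀
  have hmix : ∀ ε ∈ Set.Ioo (0 : ℝ) 1, mix ε ∈ admissiblePairs π := fun ε hε =>
    convex_admissiblePairs π hQ hQ₀ (sub_pos.2 hε.2).le hε.1.le (sub_add_cancel 1 ε)
  have hnear : ∀ᶠ ε in 𝓝[>] (0 : ℝ), ε ∈ Set.Ioo (0 : ℝ) 1 := Ioo_mem_nhdsGT one_pos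
  have hlim : Tendsto mix (𝓝[>] 0) (𝓝[Set.Ici 0] Q) := by
    refine tendsto_nhdsWithin_iff.2 ⟨?_, hnear.mono fun ε hε =>
      nonneg_of_mem_admissiblePairs (hmix ε hε)⟩
    have hcont : Continuous mix := by fun_prop
    simpa [mix] using (hcont.tendsto 0).mono_left nhdsWithin_le_nhds
  have hvalue := (continuousOn_pairValue π R ρ Q (nonneg_of_mem_admissiblePairs hQ)).tendsto.comp
    hlim
  refine le_of_tendsto ((continuous_coe_real_ereal.tendsto _).comp hvalue)
    (hnear.mono fun ε hε => ?_)
  refine pairValue_le_generalLowerBound_of_pos hp hπ hf hρ (hmix ε hε) fun s t h => ?_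
  exact add_pos_of_nonneg_of_pos
    (mul_nonneg (sub_pos.2 hε.2).le (nonneg_of_mem_admissiblePairs hQ _))
    (mul_pos hε.1 (hpos s t h))

theorem mainTheorem9_general (hR : 0 ≤ R) (hρ : 0 ≤ ρ) (hp : p ∈ stdSimplex ℝ S)
    (hπ : ∀ s, π s ∈ stdSimplex ℝ S) (hirr : π.IsIrreducible) (hf : IsUnifilar π f) :
    upperExponent (outputLaw p π f) R ρ = markovExponent π R ρ ∧
      lowerExponent (outputLaw p π f) R ρ = markovExponent π R ρ ∧
      generalLowerBound (outputLaw p π f) R ρ = markovExponent π R ρ ∧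
      generalUpperBound (outputLaw p π f) R ρ = markovExponent π R ρ := by
  have : Nonempty X := (exists_pos_of_mem_stdSimplex hp).nonempty.map f
  have hsrc := isSource_outputLaw hp hπ f
  have h₁ := markovExponent_le_generalLowerBound_outputLaw (R := R) hp hirr hf hρ
  have h₂ := generalLowerBound_le_lowerExponent hsrc hR hρ
  have h₃ : lowerExponent (outputLaw p π f) R ρ ≤ upperExponent (outputLaw p π f) R ρ :=
    liminf_le_limsup
  have h₄ := upperExponent_le_generalUpperBound (R := R) (ρ := ρ) hsrc
  have h₅ := generalUpperBound_outputLaw_le_markovExponent (R := R) hp hπ hirr f hρ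
  exact ⟨le_antisymm (h₄.trans h₅) (h₁.trans (h₂.trans h₃)),
    le_antisymm (h₃.trans (h₄.trans h₅)) (h₁.trans h₂),
    le_antisymm (h₂.trans (h₃.trans (h₄.trans h₅))) h₁,
    le_antisymm h₅ (h₁.trans (h₂.trans (h₃.trans h₄)))⟩

end Conclusion

end ShannonCipher

theorem mainTheorem9 {X S : Type*} [Fintype X] [Fintype S] (R ρ : ℝ) (hR : 0 < R) (hρ : 0 < ρ) :
    (∀ (π : Matrix X X ℝ) (p : X → ℝ), ShannonCipher.IsIrreducibleStationary π p →
      ShannonCipher.upperExponent (ShannonCipher.markovLaw p π) R ρ =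
          ShannonCipher.markovExponent π R ρ ∧
        ShannonCipher.lowerExponent (ShannonCipher.markovLaw p π) R ρ =
          ShannonCipher.markovExponent π R ρ ∧
        ShannonCipher.generalLowerBound (ShannonCipher.markovLaw p π) R ρ =
          ShannonCipher.markovExponent π R ρ ∧
        ShannonCipher.generalUpperBound (ShannonCipher.markovLaw p π) R ρ =
          ShannonCipher.markovExponent π R ρ) ∧
    (∀ (π : Matrix S S ℝ) (p : S → ℝ) (f : S → X), ShannonCipher.IsIrreducibleStationary π p →
      ShannonCipher.IsUnifilar π f →
      ShannonCipher.upperExponent (ShannonCipher.outputLaw p π f) R ρ =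
          ShannonCipher.markovExponent π R ρ ∧
        ShannonCipher.lowerExponent (ShannonCipher.outputLaw p π f) R ρ =
          ShannonCipher.markovExponent π R ρ ∧
        ShannonCipher.generalLowerBound (ShannonCipher.outputLaw p π f) R ρ =
          ShannonCipher.markovExponent π R ρ ∧
        ShannonCipher.generalUpperBound (ShannonCipher.outputLaw p π f) R ρ =
          ShannonCipher.markovExponent π R ρ) := by
  refine ⟨fun π p h => ?_, fun π p f h hf => ShannonCipher.mainTheorem9_general hR.le hρ.le
    h.initial h.stochastic h.irreducible hf⟩
  rw [← ShannonCipher.outputLaw_id]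
  exact ShannonCipher.mainTheorem9_general hR.le hρ.le h.initial h.stochastic h.irreducible
    fun _ _ _ _ _ hid => hid
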